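/- Let $k\ge 1$, $0<\delta<1/k$ and $0<\pi^*\le 1/k$. A Markov chain on $[k]=\{1,\dots,k\}$ is given by an initial distribution $\mu$ and a transition matrix $M$. Let $\mathbb M^k_{\delta,\pi^*}$ be the set of all Markov chains $(\mu,M)$ on $[k]$ ($\mu$ arbitrary) with $M_{ij}\ge\delta$ for all $i,j$ whose (unique) stationary distribution $\pi$ satisfies $\min_i\pi_i=\pi^*$, and assume that this set is non-empty (for $k\ge2$ this means $\pi^*\ge\delta$; for $k=1$ it means $\pi^*=1$). Let $f$ be convex on $(0,\infty)$ with $f(1)=0$, thrice continuously differentiable on $(0,\infty)$, with $\lim_{x\to\infty}|f(x)|/e^{cx}=0$ for all $c>0$ and $f''(1)\neq0$, and let $D_f(p,q)=\sum_{i\in[k]}q(i)f(p(i)/q(i))$, where $f(0)=\lim_{x\to0^+}f(x)$, $0f(a/0)=a\lim_{x\to\infty}f(x)/x$ and $0f(0/0)=0$. An estimator $\hat M$ maps every sample sequence $x^n\in[k]^n$ to a transition matrix $\hat M_{x^n}$. Define \[ \varepsilon_n^f=\inf_{\hat M}\ \sup_{(\mu,M)\in\mathbb M^k_{\delta,\pi^*}}\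 \max_{i\in[k]}\mathbb E_{X^n\sim(\mu,M)}\bigl[D_f(M(i,\cdot),\hat M_{X^n}(i,\cdot))\bigr], \] \[ \tilde\varepsilon_n^f=\inf_{\hat M}\ \sup_{(\mu,M)\in\mathbb M^k_{\delta,\pi^*}}\ \sum_{i\in[k]}\pi_i\,\mathbb E_{X^n\sim(\mu,M)}\bigl[D_f(M(i,\cdot),\hat M_{X^n}(i,\cdot))\bigr]. \] Write $a_n\lesssim b_n$ if $a_n\le b_n(1+o(1))$ as $n\to\infty$, with $k,\delta,\pi^*,f$ fixed. Then \[ (1-\pi^*)\frac{(k-2)kf''(1)}{2n}\lesssim\tilde\varepsilon_n^f\lesssim\frac{(k-1)kf''(1)}{2n} \] and \[ (1-\pi^*)\frac{(k-2)f''(1)}{2n\pi^*}\lesssim\varepsilon_n^f\lesssim\frac{(k-1)f''(1)}{2n\pi^*}. \] -/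

import Mathlib

open Set Filter Topology

noncomputable section

/-- `f` generates an ordinary `f`-divergence: `f` is convex on `(0, ∞)`, `f 1 = 0`, `f` is thrice
continuously differentiable on `(0, ∞)`, sub-exponential, and `f'' 1 ≠ 0`. Only the values of `f`
on `(0, ∞)` matter. -/
structure IsOrdinary (f : ℝ → ℝ) : Prop where
  convexOn : ConvexOn ℝ (Ioi 0) f
  map_one : f 1 = 0
  contDiffOn : ContDiffOn ℝ 3 f (Ioi 0)
  subexp : ∀ c : ℝ, 0 < c → Tendsto (fun x : ℝ => |f x| / Real.exp (c * x)) atTop (𝓝 0)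
  deriv_two_ne : iteratedDeriv 2 f 1 ≠ 0

/-- The summand `q f(p / q)` of an `f`-divergence, with the usual conventions for zero
probabilities: `f(0) = lim_{x → 0+} f(x)`, `0 f(p / 0) = p lim_{x → ∞} f(x) / x` and `0 f(0 / 0) = 0`.
(For convex `f` both limits exist in `(-∞, ∞]`, so each `limsup` is a limit.) -/
def fDivTerm (f : ℝ → ℝ) (p q : ℝ) : EReal :=
  if q = 0 then (p : EReal) * limsup (fun x : ℝ => ((f x / x : ℝ) : EReal)) atTop
  else if p = 0 then (q : EReal) * limsup (fun x : ℝ => (f x : EReal)) (𝓝[>] 0)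
  else ((q * f (p / q) : ℝ) : EReal)

/-- The `f`-divergence between two distributions on `Fin k`. -/
def fDiv {k : ℕ} (f : ℝ → ℝ) (p q : Fin k → ℝ) : EReal :=
  ∑ i, fDivTerm f (p i) (q i)

/-- A Markov chain model on `Fin k`: an initial distribution, a transition matrix, and a
stationary distribution of that matrix (which is determined by the matrix when all
entries of the matrix are positive). -/
structure MarkovModel (k : ℕ) where
  init : Fin k → ℝ
  trans : Matrix (Fin k) (Fin k) ℝ
  stat : Fin k → ℝ
  init_mem : init ∈ stdSimplex ℝ (Fin k)
  trans_mem : trans ∈ Matrix.rowStochastic ℝ (Fin k)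
  stat_mem : stat ∈ stdSimplex ℝ (Fin k)
  stat_eq : Matrix.vecMul stat trans = stat

/-- The probability that the first `n` samples of the chain are `x`. -/
def MarkovModel.pathProb {k : ℕ} (P : MarkovModel k) : (n : ℕ) → (Fin n → Fin k) → ℝ
  | 0, _ => 1
  | m + 1, x => P.init (x 0) * ∏ t : Fin m, P.trans (x t.castSucc) (x t.succ)

/-- An estimator from `n` samples: a transition matrix for every sample sequence. -/
abbrev Estimator (n k : ℕ) : Type := (Fin n → Fin k) → Matrix.rowStochastic ℝ (Fin k)

/-- The expected loss, under `P`, of the estimator in row `i`. -/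
def stateRisk {n k : ℕ} (L : (Fin k → ℝ) → (Fin k → ℝ) → EReal) (P : MarkovModel k)
    (E : Estimator n k) (i : Fin k) : EReal :=
  ∑ x : Fin n → Fin k, (P.pathProb n x : EReal) * L (P.trans i) ((E x).1 i)

/-- The worst-state estimation risk. -/
def worstRisk {n k : ℕ} (L : (Fin k → ℝ) → (Fin k → ℝ) → EReal) (P : MarkovModel k)
    (E : Estimator n k) : EReal :=
  ⨆ i : Fin k, stateRisk L P E i

/-- The stationary-weighted estimation risk. -/
def weightedRisk {n k : ℕ} (L : (Fin k → ℝ) → (Fin k → ℝ) → EReal) (P : MarkovModel k)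
    (E : Estimator n k) : EReal :=
  ∑ i : Fin k, (P.stat i : EReal) * stateRisk L P E i

/-- The minimax worst-state estimation risk over a class of chains, from `n` samples. -/
def minimaxWorst {k : ℕ} (L : (Fin k → ℝ) → (Fin k → ℝ) → EReal) (S : Set (MarkovModel k))
    (n : ℕ) : EReal :=
  ⨅ E : Estimator n k, ⨆ P ∈ S, worstRisk L P E

/-- The minimax stationary-weighted estimation risk over a class of chains, from `n` samples. -/
def minimaxWeighted {k : ℕ} (L : (Fin k → ℝ) → (Fin k → ℝ) → EReal) (S : Set (MarkovModel k))
    (n : ℕ) : EReal :=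
  ⨅ E : Estimator n k, ⨆ P ∈ S, weightedRisk L P E

/-- The chains on `Fin k`, with any initial distribution, all of whose transition
probabilities are at least `δ` and whose smallest stationary probability is `ρ`. -/
def chainClass (k : ℕ) (δ ρ : ℝ) : Set (MarkovModel k) :=
  {P | (∀ i j, δ ≤ P.trans i j) ∧ IsLeast (Set.range P.stat) ρ}

/-- `a ≲ b`: `a ≤ b (1 + o(1))` as `n → ∞`. -/
def AsympLE (a b : ℕ → EReal) : Prop :=
  ∃ o : ℕ → ℝ, Tendsto o atTop (𝓝 0) ∧ ∀ᶠ n in atTop, a n ≤ b n * ((1 + o n : ℝ) : EReal)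

end

/-! Upper bounds. The estimator is the empirical transition matrix, with a row replaced by the
uniform one if its state is never left or one of its entries is below δ/2. Let N_i and N_ij count
the departures from i and the transitions from i to j. The deviations N_ij − N_i M_ij are sums of
martingale differences, so they have exponential tails (`pathMean_indicator_le`) and second moment
M_ij (1 − M_ij) E N_i (`pathMean_transSum_sq`). Since departures from and arrivals at a state differ
by at most one, the counts are almost invariant under M, and the contraction given by M ≥ δ
(`sum_abs_sub_stationary_le`) makes N_i close to n π_i. Near the true row, D_f is at most (1 + η)
f''(1)/2 times a chi-square distance. As ∑_j (1 − M_ij) = k − 1, row i has risk at most (k − 1)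
f''(1) / (2 n π_i) up to a factor tending to 1. Off the concentration event the divergence is
bounded, because estimated entries are at least δ/2, and that event is exponentially likely. Both
upper bounds follow from `IsOrdinary.eventually_exists_estimator`.

Lower bounds. Around a chain whose rows all equal one distribution b, place a family M = b + ∑_a θ_a
H_a inside the class, with one direction H_a for each matrix entry a. For rows near b, every D_f
loss dominates (1 − η) f''(1)/2 times a squared error weighted by 1/b, after the estimate is
truncated (`IsOrdinary.exists_truncation`). The van Trees inequality (`van_trees`) bounds the mean
squared error of entry a along the θ_a-line by H_a(a)² over m times the information per transition,
plus the prior information. Averaging over a product prior (`sum_le_of_forall_line`) combines these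
bounds for all entries at once, which gives `IsOrdinary.eventually_local_minimax`.

Two families are needed, because the smallest stationary probability must stay exactly ρ. If ρ <
1/k, b has mass ρ at one state z and is uniform elsewhere, and column z is never perturbed; each row
keeps k − 2 free parameters and contributes (k − 2)/b_i. If ρ = 1/k, the stationary law must be
uniform, and the directions preserve row and column sums; each row contributes (k − 1)² ≥ k (k − 2).
The factor 1 − ρ in the claim is slack that absorbs the losses 1 − η with η = ρ/2. For k ≤ 2 the
lower bounds are nonpositive, and for k = 1 every risk is zero. -/

noncomputable section

/-! ### Expectations over paths and martingale estimates -/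

/-- The probability of a path with `m` transitions, for initial weights `b` and transition
weights `M`. -/
def pathWeight {k : ℕ} (b : Fin k → ℝ) (M : Fin k → Fin k → ℝ) (m : ℕ)
    (x : Fin (m + 1) → Fin k) : ℝ :=
  b (x 0) * ∏ t : Fin m, M (x t.castSucc) (x t.succ)

/-- The mean of a function of a path with `m` transitions. -/
def pathMean {k : ℕ} (b : Fin k → ℝ) (M : Fin k → Fin k → ℝ) (m : ℕ)
    (F : (Fin (m + 1) → Fin k) → ℝ) : ℝ :=
  ∑ x, pathWeight b M m x * F x

/-- The sum of `φ` over the transitions of a path. -/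
def transSum {k : ℕ} (φ : Fin k → Fin k → ℝ) {m : ℕ} (x : Fin (m + 1) → Fin k) : ℝ :=
  ∑ t : Fin m, φ (x t.castSucc) (x t.succ)

section PathMean

variable {k : ℕ} {b : Fin k → ℝ} {M : Fin k → Fin k → ℝ} {m : ℕ}

theorem pathWeight_nonneg (hb : ∀ i, 0 ≤ b i) (hM : ∀ i j, 0 ≤ M i j) (x : Fin (m + 1) → Fin k) :
    0 ≤ pathWeight b M m x :=
  mul_nonneg (hb _) (Finset.prod_nonneg fun _ _ => hM _ _)

theorem pathWeight_snoc (y : Fin (m + 1) → Fin k) (j : Fin k) :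
    pathWeight b M (m + 1) (Fin.snoc y j : Fin (m + 2) → Fin k) =
      pathWeight b M m y * M (y (Fin.last m)) j := by
  unfold pathWeight
  rw [Fin.prod_univ_castSucc, ← mul_assoc]
  have h0 : (Fin.snoc y j : Fin (m + 2) → Fin k) 0 = y 0 := by simp
  congr 1
  · rw [h0]
    congr 1
    refine Finset.prod_congr rfl fun t _ => ?_
    rw [← Fin.castSucc_succ]
    rw [Fin.snoc_castSucc (α := fun _ : Fin (m + 2) => Fin k),
      Fin.snoc_castSucc (α := fun _ : Fin (m + 2) => Fin k)]
  · rw [Fin.succ_last, Fin.snoc_last (α := fun _ : Fin (m + 2) => Fin k),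
      Fin.snoc_castSucc (α := fun _ : Fin (m + 2) => Fin k)]

theorem transSum_snoc (φ : Fin k → Fin k → ℝ) (y : Fin (m + 1) → Fin k) (j : Fin k) :
    transSum φ (Fin.snoc y j : Fin (m + 2) → Fin k) = transSum φ y + φ (y (Fin.last m)) j := by
  unfold transSum
  rw [Fin.sum_univ_castSucc]
  congr 1
  · refine Finset.sum_congr rfl fun t _ => ?_
    rw [← Fin.castSucc_succ]
    rw [Fin.snoc_castSucc (α := fun _ : Fin (m + 2) => Fin k),
      Fin.snoc_castSucc (α := fun _ : Fin (m + 2) => Fin k)]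
  · rw [Fin.succ_last, Fin.snoc_last (α := fun _ : Fin (m + 2) => Fin k),
      Fin.snoc_castSucc (α := fun _ : Fin (m + 2) => Fin k)]

/-- Conditioning on all but the last state; the moment identities below are inductions on this step.
-/
theorem pathMean_succ (F : (Fin (m + 2) → Fin k) → ℝ) :
    pathMean b M (m + 1) F =
      pathMean b M m fun y => ∑ j, M (y (Fin.last m)) j * F (Fin.snoc y j) := by
  unfold pathMean
  rw [← (Fin.snocEquiv fun _ : Fin (m + 2) => Fin k).sum_comp, Fintype.sum_prod_type,
    Finset.sum_comm]
  refine Finset.sum_congr rfl fun y _ => ?_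
  rw [Finset.mul_sum]
  refine Finset.sum_congr rfl fun j _ => ?_
  change pathWeight b M (m + 1) (Fin.snoc y j : Fin (m + 2) → Fin k) * _ = _
  rw [pathWeight_snoc, mul_assoc]
  rfl

theorem pathMean_add (F G : (Fin (m + 1) → Fin k) → ℝ) :
    pathMean b M m (fun x => F x + G x) = pathMean b M m F + pathMean b M m G := by
  simp [pathMean, mul_add, Finset.sum_add_distrib]

theorem pathMean_sub (F G : (Fin (m + 1) → Fin k) → ℝ) :
    pathMean b M m (fun x => F x - G x) = pathMean b M m F - pathMean b M m G := by
  simp [pathMean, mul_sub, Finset.sum_sub_distrib]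

theorem pathMean_const_mul (c : ℝ) (F : (Fin (m + 1) → Fin k) → ℝ) :
    pathMean b M m (fun x => c * F x) = c * pathMean b M m F := by
  simp only [pathMean, Finset.mul_sum]
  exact Finset.sum_congr rfl fun _ _ => by ring

theorem pathMean_sum {ι : Type*} (s : Finset ι) (F : ι → (Fin (m + 1) → Fin k) → ℝ) :
    pathMean b M m (fun x => ∑ i ∈ s, F i x) = ∑ i ∈ s, pathMean b M m (F i) := by
  simp only [pathMean, Finset.mul_sum]
  exact Finset.sum_comm

theorem pathMean_mono (hb : ∀ i, 0 ≤ b i) (hM : ∀ i j, 0 ≤ M i j)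
    {F G : (Fin (m + 1) → Fin k) → ℝ} (h : ∀ x, F x ≤ G x) :
    pathMean b M m F ≤ pathMean b M m G :=
  Finset.sum_le_sum fun x _ => mul_le_mul_of_nonneg_left (h x) (pathWeight_nonneg hb hM x)

theorem pathMean_const (hb : ∑ i, b i = 1) (hM : ∀ i, ∑ j, M i j = 1) (c : ℝ) :
    pathMean b M m (fun _ => c) = c := by
  induction m with
  | zero =>
    simp only [pathMean, pathWeight, Finset.univ_eq_empty, Finset.prod_empty, mul_one]
    rw [← (Equiv.funUnique (Fin 1) (Fin k)).symm.sum_comp]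
    simp [← Finset.sum_mul, hb]
  | succ m ih =>
    rw [pathMean_succ]
    simpa [← Finset.sum_mul, hM] using ih

/-- The last state is either the initial state or has just been drawn from some row of M, so bounds
for these two kinds of law suffice at every time, without mixing. -/
theorem pathMean_last_le (hb0 : ∀ i, 0 ≤ b i) (hM0 : ∀ i j, 0 ≤ M i j)
    (hb : ∑ i, b i = 1) (hM : ∀ i, ∑ j, M i j = 1) (ψ : Fin k → ℝ) {B : ℝ}
    (h0 : ∑ i, b i * ψ i ≤ B) (h1 : ∀ i, ∑ j, M i j * ψ j ≤ B) :
    pathMean b M m (fun x => ψ (x (Fin.last m))) ≤ B := by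
  cases m with
  | zero =>
    simp only [pathMean, pathWeight, Finset.univ_eq_empty, Finset.prod_empty, mul_one]
    rw [← (Equiv.funUnique (Fin 1) (Fin k)).symm.sum_comp]
    simpa using h0
  | succ m =>
    rw [pathMean_succ]
    refine (pathMean_mono hb0 hM0 (G := fun _ => B) fun x => ?_).trans
      (pathMean_const hb hM B).le
    simpa only [Fin.snoc_last (α := fun _ : Fin (m + 2) => Fin k)] using h1 _

theorem pathMean_transSum_succ (φ : Fin k → Fin k → ℝ) (hM : ∀ i, ∑ j, M i j = 1) :
    pathMean b M (m + 1) (transSum φ) =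
      pathMean b M m (transSum φ) + pathMean b M m fun y =>
        ∑ j, M (y (Fin.last m)) j * φ (y (Fin.last m)) j := by
  rw [pathMean_succ, ← pathMean_add]
  congr 1
  funext y
  simp only [transSum_snoc, mul_add, Finset.sum_add_distrib, ← Finset.sum_mul, hM, one_mul]

theorem pathMean_transSum_zero (φ : Fin k → Fin k → ℝ) :
    pathMean b M 0 (transSum φ) = 0 := by
  simp [pathMean, transSum]

theorem pathMean_transSum_le (hb0 : ∀ i, 0 ≤ b i) (hM0 : ∀ i j, 0 ≤ M i j)
    (hb : ∑ i, b i = 1) (hM : ∀ i, ∑ j, M i j = 1) (ψ : Fin k → ℝ) {B : ℝ}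
    (h0 : ∑ i, b i * ψ i ≤ B) (h1 : ∀ i, ∑ j, M i j * ψ j ≤ B) :
    pathMean b M m (transSum fun i _ => ψ i) ≤ m * B := by
  induction m with
  | zero => simp [pathMean_transSum_zero]
  | succ m ih =>
    rw [pathMean_transSum_succ _ hM]
    simp only [← Finset.sum_mul, hM, one_mul]
    have := pathMean_last_le (m := m) hb0 hM0 hb hM ψ h0 h1
    push_cast
    linarith

theorem pathMean_transSum_eq_zero (φ : Fin k → Fin k → ℝ) (hM : ∀ i, ∑ j, M i j = 1)
    (hφ : ∀ i, ∑ j, M i j * φ i j = 0) : pathMean b M m (transSum φ) = 0 := by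
  induction m with
  | zero => exact pathMean_transSum_zero _
  | succ m ih =>
    rw [pathMean_transSum_succ _ hM, ih]
    simp [hφ, pathMean]

/-- Martingale differences are orthogonal, so the cross terms vanish and only the conditional
variances remain. This serves both the variance of the counts and the Fisher information of a path.
-/
theorem pathMean_transSum_sq (φ : Fin k → Fin k → ℝ) (hM : ∀ i, ∑ j, M i j = 1)
    (hφ : ∀ i, ∑ j, M i j * φ i j = 0) :
    pathMean b M m (fun x => transSum φ x ^ 2) =
      pathMean b M m (transSum fun i _ => ∑ j, M i j * φ i j ^ 2) := by
  induction m with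
  | zero => simp [pathMean, transSum]
  | succ m ih =>
    rw [pathMean_transSum_succ _ hM, ← ih, pathMean_succ, ← pathMean_add]
    congr 1
    funext y
    simp only [← Finset.sum_mul, hM, one_mul, transSum_snoc]
    have : ∀ j, M (y (Fin.last m)) j * (transSum φ y + φ (y (Fin.last m)) j) ^ 2 =
        M (y (Fin.last m)) j * transSum φ y ^ 2 +
        2 * transSum φ y * (M (y (Fin.last m)) j * φ (y (Fin.last m)) j) +
        M (y (Fin.last m)) j * φ (y (Fin.last m)) j ^ 2 := fun j => by ring
    simp only [this, Finset.sum_add_distrib, ← Finset.mul_sum, hφ, ← Finset.sum_mul, hM]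
    ring

/-- Each step multiplies the exponential moment by at most exp(l²), because exp(y) ≤ 1 + y + y² for
|y| ≤ 1 and the linear term has conditional mean zero. -/
theorem pathMean_exp_transSum_le (φ : Fin k → Fin k → ℝ) (hb0 : ∀ i, 0 ≤ b i)
    (hM0 : ∀ i j, 0 ≤ M i j) (hb : ∑ i, b i = 1) (hM : ∀ i, ∑ j, M i j = 1)
    (hφ : ∀ i, ∑ j, M i j * φ i j = 0) (hφ1 : ∀ i j, |φ i j| ≤ 1) {l : ℝ} (hl : |l| ≤ 1) :
    pathMean b M m (fun x => Real.exp (l * transSum φ x)) ≤ Real.exp (m * l ^ 2) := by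
  induction m with
  | zero =>
    have := pathMean_const (m := 0) hb hM 1
    simpa [transSum] using this.le
  | succ m ih =>
    rw [pathMean_succ]
    have key : ∀ i, ∑ j, M i j * Real.exp (l * φ i j) ≤ Real.exp (l ^ 2) := by
      intro i
      have h1 : ∀ j, Real.exp (l * φ i j) ≤ 1 + l * φ i j + l ^ 2 := by
        intro j
        have habs : |l * φ i j| ≤ 1 := by
          rw [abs_mul]; exact mul_le_one₀ hl (abs_nonneg _) (hφ1 i j)
        have h2 := (abs_le.1 (Real.abs_exp_sub_one_sub_id_le habs)).2
        have h3 : (l * φ i j) ^ 2 ≤ l ^ 2 := by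
          rw [mul_pow]
          have : φ i j ^ 2 ≤ 1 := (sq_le_one_iff_abs_le_one _).2 (hφ1 i j)
          nlinarith [sq_nonneg l]
        linarith
      calc ∑ j, M i j * Real.exp (l * φ i j)
          ≤ ∑ j, M i j * (1 + l * φ i j + l ^ 2) :=
            Finset.sum_le_sum fun j _ => mul_le_mul_of_nonneg_left (h1 j) (hM0 i j)
        _ = ∑ j, M i j + l * ∑ j, M i j * φ i j + l ^ 2 * ∑ j, M i j := by
            simp only [Finset.mul_sum, ← Finset.sum_add_distrib]
            exact Finset.sum_congr rfl fun _ _ => by ring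
        _ = 1 + l ^ 2 := by rw [hM, hφ]; ring
        _ ≤ Real.exp (l ^ 2) := by linarith [Real.add_one_le_exp (l ^ 2)]
    calc _ ≤ pathMean b M m fun y => Real.exp (l ^ 2) * Real.exp (l * transSum φ y) := by
          refine pathMean_mono hb0 hM0 fun y => ?_
          simp only [transSum_snoc, mul_add, Real.exp_add]
          calc _ = (∑ j, M (y (Fin.last m)) j * Real.exp (l * φ (y (Fin.last m)) j)) *
                Real.exp (l * transSum φ y) := by
                rw [Finset.sum_mul]
                exact Finset.sum_congr rfl fun _ _ => by ring
            _ ≤ _ := mul_le_mul_of_nonneg_right (key _) (Real.exp_pos _).le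
      _ = Real.exp (l ^ 2) * pathMean b M m fun y => Real.exp (l * transSum φ y) :=
          pathMean_const_mul _ _
      _ ≤ Real.exp (l ^ 2) * Real.exp (m * l ^ 2) :=
          mul_le_mul_of_nonneg_left ih (Real.exp_pos _).le
      _ = _ := by rw [← Real.exp_add]; push_cast; ring_nf

theorem pathMean_indicator_le (φ : Fin k → Fin k → ℝ) (hb0 : ∀ i, 0 ≤ b i)
    (hM0 : ∀ i j, 0 ≤ M i j) (hb : ∑ i, b i = 1) (hM : ∀ i, ∑ j, M i j = 1)
    (hφ : ∀ i, ∑ j, M i j * φ i j = 0) (hφ1 : ∀ i j, |φ i j| ≤ 1) {e : ℝ} (he0 : 0 < e)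
    (he : e ≤ 1) :
    pathMean b M m (fun x => if |transSum φ x| ≤ e * m then 0 else 1) ≤
      2 * Real.exp (-(e ^ 2 / 4 * m)) := by
  -- Chernoff's bound for both tails at l = ±e/2, which minimises m l² − |l| e m, with minimum −e² m
  -- / 4.
  have hl : |e / 2| ≤ 1 := by rw [abs_le]; constructor <;> linarith
  have hl' : |-(e / 2)| ≤ 1 := by rwa [abs_neg]
  have h1 := pathMean_exp_transSum_le (m := m) φ hb0 hM0 hb hM hφ hφ1 hl
  have h2 := pathMean_exp_transSum_le (m := m) φ hb0 hM0 hb hM hφ hφ1 hl'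
  calc _ ≤ pathMean b M m (fun x => Real.exp (-(e / 2 * (e * m))) *
        (Real.exp (e / 2 * transSum φ x) + Real.exp (-(e / 2) * transSum φ x))) := by
        refine pathMean_mono hb0 hM0 fun x => ?_
        rw [mul_add, ← Real.exp_add, ← Real.exp_add]
        split_ifs with h
        · positivity
        · rw [not_le, lt_abs] at h
          rcases h with h | h
          · have : (1 : ℝ) ≤ Real.exp (-(e / 2 * (e * m)) + e / 2 * transSum φ x) := by
              rw [Real.one_le_exp_iff]; nlinarith
            linarith [Real.exp_pos (-(e / 2 * (e * m)) + -(e / 2) * transSum φ x)]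
          · have : (1 : ℝ) ≤ Real.exp (-(e / 2 * (e * m)) + -(e / 2) * transSum φ x) := by
              rw [Real.one_le_exp_iff]; nlinarith
            linarith [Real.exp_pos (-(e / 2 * (e * m)) + (e / 2) * transSum φ x)]
    _ = Real.exp (-(e / 2 * (e * m))) *
        (pathMean b M m (fun x => Real.exp (e / 2 * transSum φ x)) +
          pathMean b M m fun x => Real.exp (-(e / 2) * transSum φ x)) := by
        rw [pathMean_const_mul, pathMean_add]
    _ ≤ Real.exp (-(e / 2 * (e * m))) *
        (Real.exp (m * (e / 2) ^ 2) + Real.exp (m * (-(e / 2)) ^ 2)) :=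
        mul_le_mul_of_nonneg_left (add_le_add h1 h2) (Real.exp_pos _).le
    _ = _ := by
        rw [mul_add, ← Real.exp_add, ← Real.exp_add, two_mul]
        congr 2 <;> ring

end PathMean

/-! ### Lower bounds for the terms of an f-divergence -/

section FDivergence

variable {f : ℝ → ℝ}

/-- The excess of `f` over its tangent line at `1`. -/
def tangentGap (f : ℝ → ℝ) (x : ℝ) : ℝ := f x - deriv f 1 * (x - 1)

theorem IsOrdinary.hasDerivAt (hf : IsOrdinary f) {x : ℝ} (hx : 0 < x) :
    HasDerivAt f (deriv f x) x :=
  ((hf.contDiffOn.contDiffAt (Ioi_mem_nhds hx)).differentiableAt (by norm_num)).hasDerivAt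

theorem IsOrdinary.hasDerivAt_deriv (hf : IsOrdinary f) :
    HasDerivAt (deriv f) (iteratedDeriv 2 f 1) 1 := by
  have h2 : iteratedDeriv 2 f 1 = deriv (deriv f) 1 := by
    rw [show (2 : ℕ) = 1 + 1 from rfl, iteratedDeriv_succ, iteratedDeriv_one]
  rw [h2]
  have h3 : ContDiffOn ℝ 2 (deriv f) (Ioi 0) :=
    hf.contDiffOn.deriv_of_isOpen isOpen_Ioi (by norm_num)
  exact ((h3.contDiffAt (Ioi_mem_nhds one_pos)).differentiableAt (by norm_num)).hasDerivAt

theorem IsOrdinary.tangentGap_one (hf : IsOrdinary f) : tangentGap f 1 = 0 := by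
  simp [tangentGap, hf.map_one]

theorem IsOrdinary.convexOn_tangentGap (hf : IsOrdinary f) :
    ConvexOn ℝ (Ioi 0) (tangentGap f) := by
  refine ⟨convex_Ioi 0, fun x hx y hy a c ha hc hac => ?_⟩
  have := hf.convexOn.2 hx hy ha hc hac
  simp only [tangentGap, smul_eq_mul] at this ⊢
  have hc' : c = 1 - a := by linarith
  subst hc'
  linarith

theorem IsOrdinary.hasDerivAt_tangentGap (hf : IsOrdinary f) {x : ℝ} (hx : 0 < x) :
    HasDerivAt (tangentGap f) (deriv f x - deriv f 1) x := by
  have := (hf.hasDerivAt hx).sub (((hasDerivAt_id x).sub_const 1).const_mul (deriv f 1))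
  rw [mul_one] at this
  exact this

theorem IsOrdinary.tangentGap_nonneg (hf : IsOrdinary f) {x : ℝ} (hx : 0 < x) :
    0 ≤ tangentGap f x := by
  have hd := hf.hasDerivAt_tangentGap one_pos
  rw [sub_self] at hd
  have h1 : (1 : ℝ) ∈ Ioi (0 : ℝ) := mem_Ioi.2 one_pos
  rcases lt_trichotomy x 1 with h | h | h
  · have := hf.convexOn_tangentGap.slope_le_of_hasDerivAt (show x ∈ Ioi (0 : ℝ) from hx) h1 h hd
    rw [slope_def_field, hf.tangentGap_one, div_le_iff₀ (by linarith)] at this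
    linarith
  · rw [h, hf.tangentGap_one]
  · have := hf.convexOn_tangentGap.le_slope_of_hasDerivAt h1 (show x ∈ Ioi (0 : ℝ) from hx) h hd
    rw [slope_def_field, hf.tangentGap_one, le_div_iff₀ (by linarith)] at this
    linarith

/-- Differentiability of f' at 1 bounds the derivative of the difference by η |y − 1|; the mean
value inequality on the ball of radius |x − 1| then gives the quadratic error. -/
theorem IsOrdinary.tangentGap_taylor (hf : IsOrdinary f) {η : ℝ} (hη : 0 < η) :
    ∃ r : ℝ, 0 < r ∧ r < 1 ∧ ∀ x : ℝ, |x - 1| ≤ r →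
      |tangentGap f x - iteratedDeriv 2 f 1 / 2 * (x - 1) ^ 2| ≤ η * (x - 1) ^ 2 := by
  have h := (hasDerivAt_iff_isLittleO.1 hf.hasDerivAt_deriv).def hη
  obtain ⟨r, hr, h⟩ := Metric.eventually_nhds_iff.1 h
  -- Half of r gives the strict distance bound, and 1/2 keeps the ball inside (0, ∞).
  refine ⟨min (r / 2) (1 / 2), by positivity, (min_le_right _ _).trans_lt (by norm_num), ?_⟩
  intro x hx
  set s := Metric.closedBall (1 : ℝ) |x - 1| with hs
  have hsmem : ∀ y ∈ s, |y - 1| ≤ |x - 1| := fun y hy => by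
    simpa [hs, Real.dist_eq] using hy
  set A := iteratedDeriv 2 f 1
  have hder : ∀ y ∈ s, HasDerivWithinAt (fun y => tangentGap f y - A / 2 * (y - 1) ^ 2)
      (deriv f y - deriv f 1 - A * (y - 1)) s y := by
    intro y hy
    have hy' := (hsmem y hy).trans (hx.trans (min_le_right _ _))
    have hy0 : 0 < y := by have := (abs_le.1 hy').1; linarith
    have := (hf.hasDerivAt_tangentGap hy0).sub
      ((((hasDerivAt_id y).sub_const 1).pow 2).const_mul (A / 2))
    refine (this.congr_deriv ?_).hasDerivWithinAt
    simp only [id, Nat.add_one_sub_one, pow_one, Nat.cast_ofNat]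
    ring
  have hbd : ∀ y ∈ s, ‖deriv f y - deriv f 1 - A * (y - 1)‖ ≤ η * |x - 1| := by
    intro y hy
    have hy' := (hsmem y hy).trans (hx.trans (min_le_left _ _))
    have := h (show dist y 1 < r by rw [Real.dist_eq]; linarith)
    rw [smul_eq_mul, mul_comm] at this
    refine this.trans (mul_le_mul_of_nonneg_left (hsmem y hy) hη.le)
  have := Convex.norm_image_sub_le_of_norm_hasDerivWithin_le hder hbd
    (convex_closedBall _ _) (Metric.mem_closedBall_self (abs_nonneg _))
    (show x ∈ s by simp [hs, Real.dist_eq])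
  simp only [hf.tangentGap_one, sub_self, Real.norm_eq_abs] at this
  rw [mul_assoc, abs_mul_abs_self] at this
  convert this using 2 <;> ring

theorem IsOrdinary.deriv_two_pos (hf : IsOrdinary f) : 0 < iteratedDeriv 2 f 1 := by
  refine lt_of_le_of_ne ?_ hf.deriv_two_ne.symm
  by_contra! hneg
  obtain ⟨r, hr0, hr1, hr⟩ := hf.tangentGap_taylor (η := -iteratedDeriv 2 f 1 / 4) (by linarith)
  have h1 := hr (1 + r) (by simp [abs_of_pos hr0])
  have h2 := hf.tangentGap_nonneg (x := 1 + r) (by linarith)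
  have h3 := (abs_le.1 h1).2
  have : 0 < r ^ 2 := by positivity
  simp only [add_sub_cancel_left] at h3
  nlinarith

/-- The gap is convex and vanishes at 1, so its slopes seen from 1 only grow in modulus: a linear
bound at distance r persists at larger distances. -/
theorem IsOrdinary.mul_abs_le_tangentGap (hf : IsOrdinary f) {r κ : ℝ} (hr0 : 0 < r) (hr1 : r < 1)
    (h1 : κ * r ≤ tangentGap f (1 + r)) (h2 : κ * r ≤ tangentGap f (1 - r)) {x : ℝ} (hx : 0 < x)
    (hxr : r ≤ |x - 1|) : κ * |x - 1| ≤ tangentGap f x := by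
  have key : ∀ y : ℝ, 0 < y → ∀ t : ℝ, 0 < t → t ≤ 1 → y = (1 - t) * 1 + t * x →
      tangentGap f y ≤ t * tangentGap f x := by
    intro y _ t ht ht1 hyt
    have := hf.convexOn_tangentGap.2 (show (1 : ℝ) ∈ Ioi (0 : ℝ) from mem_Ioi.2 one_pos)
      (show x ∈ Ioi (0 : ℝ) from hx) (sub_nonneg.2 ht1) ht.le (by ring)
    simp only [smul_eq_mul, hf.tangentGap_one, mul_zero, zero_add] at this
    rwa [← hyt] at this
  rcases le_total 1 x with h | h
  · rw [abs_of_nonneg (by linarith)] at hxr ⊢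
    have hx1 : 0 < x - 1 := by linarith
    have := key (1 + r) (by linarith) (r / (x - 1)) (by positivity)
      ((div_le_one hx1).2 hxr) (by field_simp; ring)
    have h4 := h1.trans this
    rw [div_mul_eq_mul_div, le_div_iff₀ hx1] at h4
    nlinarith
  · rw [abs_of_nonpos (by linarith)] at hxr ⊢
    have hx1 : 0 < 1 - x := by linarith
    have := key (1 - r) (by linarith) (r / (1 - x)) (by positivity)
      ((div_le_one hx1).2 (by linarith)) (by field_simp; ring)
    have h4 := h2.trans this
    rw [div_mul_eq_mul_div, le_div_iff₀ hx1] at h4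
    nlinarith

theorem fDivTerm_of_pos {p q : ℝ} (hp : 0 < p) (hq : 0 < q) :
    fDivTerm f p q = ((deriv f 1 * (p - q) + q * tangentGap f (p / q) : ℝ) : EReal) := by
  rw [fDivTerm, if_neg hq.ne', if_neg hp.ne']
  congr 1
  unfold tangentGap
  field_simp
  ring

/-- The case of an estimate that gives no mass to a possible outcome: the linear lower bound on the
gap passes to the limit of f(x)/x. -/
theorem le_fDivTerm_zero {p κ r : ℝ} (hp : 0 < p)
    (h : ∀ x : ℝ, 0 < x → r ≤ |x - 1| → κ * |x - 1| ≤ tangentGap f x) :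
    ((deriv f 1 * p + κ * p : ℝ) : EReal) ≤ fDivTerm f p 0 := by
  rw [fDivTerm, if_pos rfl, ← add_mul, mul_comm, EReal.coe_mul]
  refine mul_le_mul_of_nonneg_left ?_ (by exact_mod_cast hp.le)
  have ht : Tendsto (fun x : ℝ => (((deriv f 1 + κ) * (1 - x⁻¹) : ℝ) : EReal)) atTop
      (𝓝 ((deriv f 1 + κ : ℝ) : EReal)) := by
    refine (continuous_coe_real_ereal.tendsto _).comp ?_
    have : Tendsto (fun x : ℝ => (deriv f 1 + κ) * (1 - x⁻¹)) atTop
        (𝓝 ((deriv f 1 + κ) * (1 - 0))) :=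
      (tendsto_inv_atTop_zero.const_sub 1).const_mul _
    simpa using this
  rw [← ht.limsup_eq]
  refine limsup_le_limsup ?_
  filter_upwards [eventually_ge_atTop (1 + |r|)] with x hx
  have hx1 : 1 ≤ x := by linarith [abs_nonneg r]
  rw [EReal.coe_le_coe_iff, le_div_iff₀ (by linarith)]
  have := h x (by linarith) (by
    rw [abs_of_nonneg (by linarith)]; linarith [le_abs_self r])
  rw [abs_of_nonneg (by linarith), tangentGap] at this
  have e : (deriv f 1 + κ) * (1 - x⁻¹) * x = (deriv f 1 + κ) * (x - 1) := by
    field_simp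
  rw [e]
  linarith

theorem EReal.coe_sum_finset {ι : Type*} (s : Finset ι) (g : ι → ℝ) :
    ((∑ i ∈ s, g i : ℝ) : EReal) = ∑ i ∈ s, (g i : EReal) := by
  classical
  induction s using Finset.induction_on with
  | empty => simp
  | insert a s ha ih => rw [Finset.sum_insert ha, Finset.sum_insert ha, EReal.coe_add, ih]

/-- A lower bound for the terms of an `f`-divergence: quadratic near the diagonal and linear far
from it. -/
theorem IsOrdinary.exists_le_fDivTerm (hf : IsOrdinary f) {η : ℝ} (hη0 : 0 < η) (hη1 : η < 1) :
    ∃ r κ : ℝ, 0 < r ∧ 0 < κ ∧ ∀ p q : ℝ, 0 < p → 0 ≤ q →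
      (|p - q| ≤ r * q →
        ((deriv f 1 * (p - q) + (1 - η) * (iteratedDeriv 2 f 1 / 2) * ((p - q) ^ 2 / q) : ℝ) :
          EReal) ≤ fDivTerm f p q) ∧
      (r * q < |p - q| → ((deriv f 1 * (p - q) + κ * |p - q| : ℝ) : EReal) ≤ fDivTerm f p q) := by
  have hA := hf.deriv_two_pos
  set A := iteratedDeriv 2 f 1 with hAdef
  obtain ⟨r, hr0, hr1, hr⟩ := hf.tangentGap_taylor (η := η * (A / 2)) (by positivity)
  rw [← hAdef] at hr
  have hlow : ∀ x : ℝ, |x - 1| ≤ r → (1 - η) * (A / 2) * (x - 1) ^ 2 ≤ tangentGap f x := by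
    intro x hx
    have := (abs_le.1 (hr x hx)).1
    linarith
  have hκ : 0 < (1 - η) * (A / 2) * r := by
    have : 0 < 1 - η := by linarith
    positivity
  have hfar : ∀ x : ℝ, 0 < x → r ≤ |x - 1| →
      (1 - η) * (A / 2) * r * |x - 1| ≤ tangentGap f x := by
    intro x hx hxr
    refine hf.mul_abs_le_tangentGap hr0 hr1 ?_ ?_ hx hxr
    · have := hlow (1 + r) (by simp [abs_of_pos hr0])
      simp only [add_sub_cancel_left] at this
      linarith
    · have := hlow (1 - r) (by simp [abs_of_pos hr0])
      have e : (1 - r - 1) ^ 2 = r ^ 2 := by ring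
      rw [e] at this
      linarith
  refine ⟨r, _, hr0, hκ, fun p q hp hq => ⟨fun h => ?_, fun h => ?_⟩⟩
  · have hq0 : 0 < q := by
      rcases hq.eq_or_lt with h0 | h0
      · rw [← h0] at h
        simp only [sub_zero, mul_zero] at h
        exact absurd h (not_le.2 (abs_pos.2 hp.ne'))
      · exact h0
    rw [fDivTerm_of_pos hp hq0, EReal.coe_le_coe_iff]
    have e : p / q - 1 = (p - q) / q := by field_simp
    have := hlow (p / q) (by rw [e, abs_div, abs_of_pos hq0, div_le_iff₀ hq0]; exact h)
    rw [e] at this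
    have h2 := mul_le_mul_of_nonneg_left this hq0.le
    have e2 : q * ((1 - η) * (A / 2) * ((p - q) / q) ^ 2) =
      (1 - η) * (A / 2) * ((p - q) ^ 2 / q) := by field_simp
    linarith
  · rcases hq.eq_or_lt with h0 | hq0
    · rw [← h0, sub_zero, abs_of_pos hp]
      exact le_fDivTerm_zero hp hfar
    · rw [fDivTerm_of_pos hp hq0, EReal.coe_le_coe_iff]
      have e : p / q - 1 = (p - q) / q := by field_simp
      have := hfar (p / q) (by positivity) (by
        rw [e, abs_div, abs_of_pos hq0, le_div_iff₀ hq0]; exact h.le)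
      rw [e, abs_div, abs_of_pos hq0] at this
      have h2 := mul_le_mul_of_nonneg_left this hq0.le
      have e2 : q * ((1 - η) * (A / 2) * r * (|p - q| / q)) =
        (1 - η) * (A / 2) * r * |p - q| := by field_simp
      linarith

theorem IsOrdinary.tangent_le_fDivTerm (hf : IsOrdinary f) {p q : ℝ} (hp : 0 < p) (hq : 0 ≤ q) :
    ((deriv f 1 * (p - q) : ℝ) : EReal) ≤ fDivTerm f p q := by
  obtain ⟨r, κ, hr, hκ, h⟩ := hf.exists_le_fDivTerm (η := 1 / 2) (by norm_num) (by norm_num)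
  have hA := hf.deriv_two_pos
  rcases le_or_gt |p - q| (r * q) with h' | h'
  · refine le_trans ?_ ((h p q hp hq).1 h')
    rw [EReal.coe_le_coe_iff]
    have : 0 ≤ (1 - 1 / 2) * (iteratedDeriv 2 f 1 / 2) * ((p - q) ^ 2 / q) := by positivity
    linarith
  · refine le_trans ?_ ((h p q hp hq).2 h')
    rw [EReal.coe_le_coe_iff]
    have : 0 ≤ κ * |p - q| := by positivity
    linarith

/-- The linear parts c (p_i − q_i) of termwise bounds cancel in the sum. -/
theorem le_fDiv_of_le_fDivTerm {k : ℕ} {c : ℝ} {p q : Fin k → ℝ} (hpq : ∑ i, p i = ∑ i, q i)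
    (X : Fin k → ℝ) (h : ∀ i, ((c * (p i - q i) + X i : ℝ) : EReal) ≤ fDivTerm f (p i) (q i)) :
    ((∑ i, X i : ℝ) : EReal) ≤ fDiv f p q := by
  have e : ∑ i, X i = ∑ i, (c * (p i - q i) + X i) := by
    rw [Finset.sum_add_distrib, ← Finset.mul_sum, Finset.sum_sub_distrib, hpq]
    ring
  rw [e, EReal.coe_sum_finset]
  exact Finset.sum_le_sum fun i _ => h i

theorem IsOrdinary.fDiv_nonneg (hf : IsOrdinary f) {k : ℕ} {p q : Fin k → ℝ}
    (hpq : ∑ i, p i = ∑ i, q i) (hp : ∀ i, 0 < p i) (hq : ∀ i, 0 ≤ q i) : 0 ≤ fDiv f p q := by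
  have := le_fDiv_of_le_fDivTerm (f := f) (c := deriv f 1) hpq (fun _ => 0) fun i => by
    rw [add_zero]; exact hf.tangent_le_fDivTerm (hp i) (hq i)
  simpa using this

end FDivergence

/-! ### Comparison of f-divergences with quadratic losses -/

section FDivergenceBounds

variable {f : ℝ → ℝ} {k : ℕ}

/-- Reduces the lower bounds to quadratic loss with fixed weights 1/b. An estimate q far from b
costs a fixed amount, whereas b itself, for p very near b, costs less; so `T` may replace a far q by
b. -/
theorem IsOrdinary.exists_truncation (hf : IsOrdinary f) {b : Fin k → ℝ} {β : ℝ} (hβ : 0 < β)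
    (hb : ∀ j, β ≤ b j) {η : ℝ} (hη0 : 0 < η) (hη1 : η < 1) :
    ∃ ε : ℝ, 0 < ε ∧ ∃ T : (Fin k → ℝ) → Fin k → ℝ, ∀ p q : Fin k → ℝ,
      ∑ j, p j = 1 → ∑ j, q j = 1 → (∀ j, 0 < p j) → (∀ j, 0 ≤ q j) → (∀ j, |p j - b j| ≤ ε) →
      (((1 - η) * (iteratedDeriv 2 f 1 / 2) * ∑ j, (p j - T q j) ^ 2 / b j : ℝ) : EReal) ≤
        fDiv f p q := by
  classical
  have ha : 0 < iteratedDeriv 2 f 1 / 2 := half_pos hf.deriv_two_pos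
  obtain ⟨r, κ, hr, hκ, hterm⟩ := hf.exists_le_fDivTerm (η := η / 2) (by linarith) (by linarith)
  set a := iteratedDeriv 2 f 1 / 2 with hadef
  -- The three bounds serve, for q within e₁ of b: the exchange of 1/q for 1/b at the cost of a
  -- factor 1 − η/2, the quadratic regime |p − q| ≤ r q, and q ≥ b/2.
  set ζ := min (η / 2) (min (r / 4) (1 / 2)) with hζ
  have hζ0 : 0 < ζ := by positivity
  have hζ1 : ζ ≤ η / 2 := min_le_left _ _
  have hζ2 : ζ ≤ r / 4 := (min_le_right _ _).trans (min_le_left _ _)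
  have hζ3 : ζ ≤ 1 / 2 := (min_le_right _ _).trans (min_le_right _ _)
  set e₁ := β * ζ with he₁
  have he₁0 : 0 < e₁ := by positivity
  have hη2 : 0 < 1 - η / 2 := by linarith
  -- A lower bound for the divergence once some coordinate has |p − q| ≥ e₁/2: the linear and the
  -- quadratic regime, the latter with q ≤ 1.
  set K := min (κ * (e₁ / 2)) ((1 - η / 2) * a * (e₁ / 2) ^ 2) with hK
  have hK0 : 0 < K := by positivity
  -- The first bound keeps p at distance e₁/2 from a far q; the other two make the quadratic loss of
  -- b at most K.
  refine ⟨min (e₁ / 2) (min 1 (K * β / (a * k + 1))), by positivity,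
    fun q => if ∀ j, |q j - b j| ≤ e₁ then q else b, fun p q hp1 hq1 hp hq hpb => ?_⟩
  have hpb1 : ∀ j, |p j - b j| ≤ e₁ / 2 := fun j => (hpb j).trans (min_le_left _ _)
  have hpb2 : ∀ j, |p j - b j| ≤ 1 := fun j =>
    (hpb j).trans ((min_le_right _ _).trans (min_le_left _ _))
  have hpb3 : ∀ j, |p j - b j| ≤ K * β / (a * k + 1) := fun j =>
    (hpb j).trans ((min_le_right _ _).trans (min_le_right _ _))
  have hb0 : ∀ j, 0 < b j := fun j => hβ.trans_le (hb j)
  by_cases hT : ∀ j, |q j - b j| ≤ e₁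
  · simp only [if_pos hT]
    rw [Finset.mul_sum]
    refine le_fDiv_of_le_fDivTerm (c := deriv f 1) (hp1.trans hq1.symm) _ fun j => ?_
    have h1 := abs_le.1 (hpb1 j)
    have h2 := abs_le.1 (hT j)
    have h3 : β * ζ ≤ b j * ζ := mul_le_mul_of_nonneg_right (hb j) hζ0.le
    have h4 : β * ζ ≤ β * (1 / 2) := mul_le_mul_of_nonneg_left hζ3 hβ.le
    have hqb : b j / 2 ≤ q j := by linarith [hb j]
    have hq0 : 0 < q j := by linarith [hb0 j]
    have h5 : |p j - q j| ≤ r * q j := by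
      have h6 : b j * ζ ≤ b j * (r / 4) := mul_le_mul_of_nonneg_left hζ2 (hb0 j).le
      have h7 : r * (b j / 2) ≤ r * q j := mul_le_mul_of_nonneg_left hqb hr.le
      rw [abs_le]; constructor <;> nlinarith
    refine le_trans ?_ ((hterm (p j) (q j) (hp j) (hq j)).1 h5)
    rw [EReal.coe_le_coe_iff]
    have h8 : (1 - η / 2) * ((p j - q j) ^ 2 / b j) ≤ (p j - q j) ^ 2 / q j := by
      rw [mul_div_assoc', div_le_div_iff₀ (hb0 j) hq0]
      have h9 : (1 - η / 2) * q j ≤ b j := by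
        have h10 : b j * ζ ≤ b j * (η / 2) := mul_le_mul_of_nonneg_left hζ1 (hb0 j).le
        have h11 : q j ≤ b j * (1 + η / 2) := by linarith
        calc (1 - η / 2) * q j ≤ (1 - η / 2) * (b j * (1 + η / 2)) :=
              mul_le_mul_of_nonneg_left h11 hη2.le
          _ ≤ b j := by nlinarith [hb0 j, sq_nonneg η]
      nlinarith [sq_nonneg (p j - q j)]
    have h12 : 0 ≤ (p j - q j) ^ 2 / b j := div_nonneg (sq_nonneg _) (hb0 j).le
    have h13 : (1 - η) ≤ (1 - η / 2) * (1 - η / 2) := by nlinarith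
    have h14 : (1 - η) * (a * ((p j - q j) ^ 2 / b j)) ≤
        (1 - η / 2) * (1 - η / 2) * (a * ((p j - q j) ^ 2 / b j)) :=
      mul_le_mul_of_nonneg_right h13 (by positivity)
    have h15 := mul_le_mul_of_nonneg_left h8 (mul_pos hη2 ha).le
    linarith
  · simp only [if_neg hT]
    push Not at hT
    obtain ⟨j₀, hj₀⟩ := hT
    let X : Fin k → ℝ := fun j => if |p j - q j| ≤ r * q j then
      (1 - η / 2) * a * ((p j - q j) ^ 2 / q j) else κ * |p j - q j|
    have hX0 : ∀ j, 0 ≤ X j := by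
      intro j
      have := hq j
      simp only [X]
      split_ifs <;> positivity
    have hX := le_fDiv_of_le_fDivTerm (f := f) (c := deriv f 1) (hp1.trans hq1.symm) X fun j => by
      simp only [X]
      split_ifs with h
      · exact (hterm (p j) (q j) (hp j) (hq j)).1 h
      · exact (hterm (p j) (q j) (hp j) (hq j)).2 (not_le.1 h)
    refine le_trans ?_ hX
    rw [EReal.coe_le_coe_iff]
    have hXK : K ≤ X j₀ := by
      have h1 : e₁ / 2 ≤ |p j₀ - q j₀| := by
        have := abs_sub_le (q j₀) (p j₀) (b j₀)
        rw [abs_sub_comm (q j₀) (p j₀)] at this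
        linarith [hpb1 j₀]
      simp only [X]
      split_ifs with h
      · refine (min_le_right _ _).trans ?_
        refine mul_le_mul_of_nonneg_left ?_ (mul_pos hη2 ha).le
        have hq1' : q j₀ ≤ 1 := hq1 ▸ Finset.single_le_sum (fun i _ => hq i) (Finset.mem_univ j₀)
        have hq0 : 0 < q j₀ := by
          rcases (hq j₀).eq_or_lt with h0 | h0
          · rw [← h0] at h; rw [← h0] at h1; linarith
          · exact h0
        rw [le_div_iff₀ hq0]
        have : (e₁ / 2) ^ 2 ≤ (p j₀ - q j₀) ^ 2 := by
          rw [← sq_abs (p j₀ - q j₀)]; gcongr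
        nlinarith [sq_nonneg (e₁ / 2)]
      · exact (min_le_left _ _).trans (mul_le_mul_of_nonneg_left h1 hκ.le)
    refine le_trans ?_ (hXK.trans (Finset.single_le_sum (fun i _ => hX0 i) (Finset.mem_univ j₀)))
    have hak : 0 < a * k + 1 := by positivity
    have h1 : ∀ j, (p j - b j) ^ 2 / b j ≤ K / (a * k + 1) := by
      intro j
      rw [div_le_iff₀ (hb0 j)]
      have h2 : (p j - b j) ^ 2 ≤ K * β / (a * k + 1) := by
        rw [← sq_abs, sq]
        calc |p j - b j| * |p j - b j| ≤ 1 * (K * β / (a * k + 1)) :=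
              mul_le_mul (hpb2 j) (hpb3 j) (abs_nonneg _) zero_le_one
          _ = _ := one_mul _
      have h3 : K / (a * k + 1) * β ≤ K / (a * k + 1) * b j :=
        mul_le_mul_of_nonneg_left (hb j) (by positivity)
      have h4 : K * β / (a * k + 1) = K / (a * k + 1) * β := by ring
      linarith
    have h2 : ∑ j, (p j - b j) ^ 2 / b j ≤ k * (K / (a * k + 1)) := by
      have := Finset.sum_le_sum fun j (_ : j ∈ Finset.univ) => h1 j
      simpa using this
    have h3 : 0 ≤ ∑ j, (p j - b j) ^ 2 / b j :=
      Finset.sum_nonneg fun j _ => div_nonneg (sq_nonneg _) (hb0 j).le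
    calc (1 - η) * a * ∑ j, (p j - b j) ^ 2 / b j
        ≤ a * ∑ j, (p j - b j) ^ 2 / b j := by
          have : 0 ≤ η * (a * ∑ j, (p j - b j) ^ 2 / b j) := by positivity
          linarith
      _ ≤ a * (k * (K / (a * k + 1))) := mul_le_mul_of_nonneg_left h2 ha.le
      _ = K * (a * k) / (a * k + 1) := by ring
      _ ≤ K := by rw [div_le_iff₀ hak]; nlinarith

theorem fDiv_of_pos {p q : Fin k → ℝ} (hp : ∀ j, 0 < p j) (hq : ∀ j, 0 < q j)
    (hpq : ∑ j, p j = ∑ j, q j) :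
    fDiv f p q = ((∑ j, q j * tangentGap f (p j / q j) : ℝ) : EReal) := by
  rw [fDiv, Finset.sum_congr rfl fun j _ => fDivTerm_of_pos (f := f) (hp j) (hq j),
    ← EReal.coe_sum_finset, Finset.sum_add_distrib, ← Finset.mul_sum, Finset.sum_sub_distrib, hpq]
  simp

theorem IsOrdinary.exists_fDiv_le_const (hf : IsOrdinary f) {δ : ℝ} (hδ : 0 < δ) :
    ∃ C : ℝ, 0 ≤ C ∧ ∀ p q : Fin k → ℝ, ∑ j, p j = 1 → ∑ j, q j = 1 → (∀ j, δ ≤ p j) →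
      (∀ j, δ / 2 ≤ q j) → fDiv f p q ≤ (C : EReal) := by
  -- The ratios p/q lie in [δ, 2/δ], since p ∈ [δ, 1] and q ∈ [δ/2, 1].
  have hcont : ContinuousOn (tangentGap f) (Icc δ (2 / δ)) := fun x hx =>
    (hf.hasDerivAt_tangentGap (hδ.trans_le hx.1)).continuousAt.continuousWithinAt
  obtain ⟨C, hC⟩ := isCompact_Icc.exists_bound_of_continuousOn hcont
  refine ⟨|C|, abs_nonneg C, fun p q hp1 hq1 hp hq => ?_⟩
  have hp0 : ∀ j, 0 < p j := fun j => hδ.trans_le (hp j)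
  have hq0 : ∀ j, 0 < q j := fun j => (half_pos hδ).trans_le (hq j)
  rw [fDiv_of_pos hp0 hq0 (hp1.trans hq1.symm), EReal.coe_le_coe_iff]
  calc ∑ j, q j * tangentGap f (p j / q j) ≤ ∑ j, q j * |C| := by
        refine Finset.sum_le_sum fun j _ => mul_le_mul_of_nonneg_left ?_ (hq0 j).le
        have hpj : p j ≤ 1 :=
          hp1 ▸ Finset.single_le_sum (fun i _ => (hp0 i).le) (Finset.mem_univ j)
        have hqj : q j ≤ 1 :=
          hq1 ▸ Finset.single_le_sum (fun i _ => (hq0 i).le) (Finset.mem_univ j)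
        refine (le_abs_self _).trans ((hC _ ⟨?_, ?_⟩).trans (le_abs_self C))
        · rw [le_div_iff₀ (hq0 j)]; nlinarith [hp j]
        · rw [div_le_div_iff₀ (hq0 j) hδ]; nlinarith [hq j]
    _ = |C| := by rw [← Finset.sum_mul, hq1, one_mul]

/-- One factor 1 + ζ comes from Taylor's formula and one from exchanging the denominator q for p; ζ
≤ min(1, η/3) makes their product at most 1 + η. -/
theorem IsOrdinary.exists_fDiv_le_quadratic (hf : IsOrdinary f) {δ : ℝ} (hδ : 0 < δ) {η : ℝ}
    (hη : 0 < η) :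
    ∃ s : ℝ, 0 < s ∧ ∀ p q : Fin k → ℝ, ∑ j, p j = 1 → ∑ j, q j = 1 → (∀ j, δ ≤ p j) →
      (∀ j, δ / 2 ≤ q j) → (∀ j, |q j - p j| ≤ s) →
      fDiv f p q ≤
        (((1 + η) * (iteratedDeriv 2 f 1 / 2) * ∑ j, (q j - p j) ^ 2 / p j : ℝ) : EReal) := by
  have ha : 0 < iteratedDeriv 2 f 1 / 2 := half_pos hf.deriv_two_pos
  set ζ := min 1 (η / 3) with hζ
  have hζ0 : 0 < ζ := by positivity
  have hζ1 : ζ ≤ 1 := min_le_left _ _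
  have hζ2 : ζ ≤ η / 3 := min_le_right _ _
  obtain ⟨r, hr0, hr1, hr⟩ := hf.tangentGap_taylor (η := ζ * (iteratedDeriv 2 f 1 / 2))
    (by positivity)
  set a := iteratedDeriv 2 f 1 / 2 with hadef
  refine ⟨min r ζ * (δ / 2), by positivity, fun p q hp1 hq1 hp hq hpq => ?_⟩
  have hp0 : ∀ j, 0 < p j := fun j => hδ.trans_le (hp j)
  have hq0 : ∀ j, 0 < q j := fun j => (half_pos hδ).trans_le (hq j)
  rw [fDiv_of_pos hp0 hq0 (hp1.trans hq1.symm), EReal.coe_le_coe_iff, Finset.mul_sum]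
  refine Finset.sum_le_sum fun j _ => ?_
  have h1 : |p j - q j| ≤ min r ζ * q j := by
    rw [abs_sub_comm]
    exact (hpq j).trans (mul_le_mul_of_nonneg_left (hq j) (by positivity))
  have h2 : |p j - q j| ≤ r * q j :=
    h1.trans (mul_le_mul_of_nonneg_right (min_le_left _ _) (hq0 j).le)
  have h3 : |p j - q j| ≤ ζ * q j :=
    h1.trans (mul_le_mul_of_nonneg_right (min_le_right _ _) (hq0 j).le)
  have e : p j / q j - 1 = (p j - q j) / q j := by field_simp [(hq0 j).ne']
  have h4 := (abs_le.1 (hr (p j / q j)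
    (by rw [e, abs_div, abs_of_pos (hq0 j), div_le_iff₀ (hq0 j)]; exact h2))).2
  rw [e] at h4
  have h5 : tangentGap f (p j / q j) ≤ (1 + ζ) * a * ((p j - q j) / q j) ^ 2 := by linarith
  have h6 : q j * tangentGap f (p j / q j) ≤ (1 + ζ) * a * ((p j - q j) ^ 2 / q j) := by
    refine (mul_le_mul_of_nonneg_left h5 (hq0 j).le).trans (le_of_eq ?_)
    have := (hq0 j).ne'
    field_simp
  have h7 : (p j - q j) ^ 2 / q j ≤ (1 + ζ) * ((p j - q j) ^ 2 / p j) := by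
    rw [mul_div_assoc', div_le_div_iff₀ (hq0 j) (hp0 j)]
    have : p j ≤ (1 + ζ) * q j := by linarith [(abs_le.1 h3).2]
    nlinarith [sq_nonneg (p j - q j)]
  have h8 : 0 ≤ (p j - q j) ^ 2 / p j := div_nonneg (sq_nonneg _) (hp0 j).le
  have h9 : (1 + ζ) * (1 + ζ) ≤ 1 + η := by nlinarith
  have h10 := mul_le_mul_of_nonneg_left h7 (by positivity : 0 ≤ (1 + ζ) * a)
  have h11 := mul_le_mul_of_nonneg_right h9 (mul_nonneg ha.le h8)
  have e2 : (q j - p j) ^ 2 = (p j - q j) ^ 2 := by ring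
  rw [e2]
  linarith

end FDivergenceBounds

/-! ### Chains as real weights, and risks as path expectations -/

namespace MarkovModel

variable {k : ℕ} (P : MarkovModel k)

/-- The transition probabilities of a chain, as a function. -/
def prob (i j : Fin k) : ℝ := P.trans i j

theorem prob_nonneg (i j : Fin k) : 0 ≤ P.prob i j := P.trans_mem.1 i j

theorem sum_prob (i : Fin k) : ∑ j, P.prob i j = 1 :=
  (Matrix.mem_rowStochastic_iff_sum.1 P.trans_mem).2 i

theorem sum_stat_mul_prob (j : Fin k) : ∑ i, P.stat i * P.prob i j = P.stat j :=
  congrFun P.stat_eq j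

end MarkovModel

section RiskBounds

variable {k m : ℕ} {L : (Fin k → ℝ) → (Fin k → ℝ) → EReal}

theorem stateRisk_le_pathMean {P : MarkovModel k} {E : Estimator (m + 1) k} {i : Fin k}
    {B : (Fin (m + 1) → Fin k) → ℝ} (h : ∀ x, L (P.prob i) ((E x).1 i) ≤ (B x : EReal)) :
    stateRisk L P E i ≤ (pathMean P.init P.prob m B : EReal) := by
  unfold pathMean
  rw [EReal.coe_sum_finset]
  refine Finset.sum_le_sum fun x _ => ?_
  rw [EReal.coe_mul]
  refine mul_le_mul_of_nonneg_left (h x) ?_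
  exact_mod_cast pathWeight_nonneg P.init_mem.1 P.prob_nonneg x

theorem pathMean_le_stateRisk {P : MarkovModel k} {E : Estimator (m + 1) k} {i : Fin k}
    {B : (Fin (m + 1) → Fin k) → ℝ} (h : ∀ x, (B x : EReal) ≤ L (P.prob i) ((E x).1 i)) :
    (pathMean P.init P.prob m B : EReal) ≤ stateRisk L P E i := by
  unfold pathMean
  rw [EReal.coe_sum_finset]
  refine Finset.sum_le_sum fun x _ => ?_
  rw [EReal.coe_mul]
  refine mul_le_mul_of_nonneg_left (h x) ?_
  exact_mod_cast pathWeight_nonneg P.init_mem.1 P.prob_nonneg x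

end RiskBounds

/-! ### Transition counts and contraction to the stationary law -/

section Counts

variable {k m : ℕ}

/-- The number of transitions of a path that start in `i`. -/
def visitCount (i : Fin k) (x : Fin (m + 1) → Fin k) : ℝ :=
  transSum (fun i' _ => if i' = i then 1 else 0) x

/-- The number of transitions of a path from `i` to `j`. -/
def transCount (i j : Fin k) (x : Fin (m + 1) → Fin k) : ℝ :=
  transSum (fun i' j' => if i' = i then (if j' = j then 1 else 0) else 0) x

/-- The deviation of one transition into `j` from its conditional mean, on the state `i`. -/
def transDev (M : Fin k → Fin k → ℝ) (i j : Fin k) (i' j' : Fin k) : ℝ :=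
  if i' = i then (if j' = j then 1 else 0) - M i j else 0

theorem sum_transCount (i : Fin k) (x : Fin (m + 1) → Fin k) :
    ∑ j, transCount i j x = visitCount i x := by
  unfold transCount visitCount transSum
  rw [Finset.sum_comm]
  refine Finset.sum_congr rfl fun t _ => ?_
  beta_reduce
  split_ifs with h <;> simp

theorem sum_visitCount (x : Fin (m + 1) → Fin k) : ∑ i, visitCount i x = m := by
  unfold visitCount transSum
  rw [Finset.sum_comm]
  simp

theorem transSum_transDev (M : Fin k → Fin k → ℝ) (i j : Fin k) (x : Fin (m + 1) → Fin k) :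
    transSum (transDev M i j) x = transCount i j x - visitCount i x * M i j := by
  unfold transCount visitCount transSum
  rw [Finset.sum_mul, ← Finset.sum_sub_distrib]
  refine Finset.sum_congr rfl fun t _ => ?_
  unfold transDev
  beta_reduce
  split_ifs <;> ring

/-- Departures from j omit the last state and arrivals at j omit the first, so only the endpoints
contribute to the difference. -/
theorem abs_visitCount_sub_le (j : Fin k) (x : Fin (m + 1) → Fin k) :
    |visitCount j x - ∑ i, transCount i j x| ≤ 1 := by
  have h1 : ∑ i, transCount i j x = ∑ t : Fin m, if x t.succ = j then (1 : ℝ) else 0 := by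
    unfold transCount transSum
    rw [Finset.sum_comm]
    refine Finset.sum_congr rfl fun t _ => ?_
    simp
  have h2 := Fin.sum_univ_castSucc fun t : Fin (m + 1) => if x t = j then (1 : ℝ) else 0
  have h3 := Fin.sum_univ_succ fun t : Fin (m + 1) => if x t = j then (1 : ℝ) else 0
  have h4 : visitCount j x - ∑ i, transCount i j x =
      (if x 0 = j then 1 else 0) - if x (Fin.last m) = j then 1 else 0 := by
    rw [h1, visitCount, transSum]
    linarith
  rw [h4]
  split_ifs <;> norm_num

theorem sum_mul_transDev {M : Fin k → Fin k → ℝ} (hM : ∀ i, ∑ j, M i j = 1) (i j i' : Fin k) :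
    ∑ j', M i' j' * transDev M i j i' j' = 0 := by
  unfold transDev
  split_ifs with h
  · subst h
    simp [mul_sub, Finset.sum_sub_distrib, ← Finset.sum_mul, hM]
  · simp

theorem sum_mul_transDev_sq {M : Fin k → Fin k → ℝ} (hM : ∀ i, ∑ j, M i j = 1) (i j i' : Fin k) :
    ∑ j', M i' j' * transDev M i j i' j' ^ 2 =
      M i j * (1 - M i j) * if i' = i then 1 else 0 := by
  unfold transDev
  split_ifs with h
  · subst h
    have : ∀ j', M i' j' * ((if j' = j then 1 else 0) - M i' j) ^ 2 =
        (if j' = j then M i' j' else 0) * (1 - 2 * M i' j) + M i' j' * M i' j ^ 2 := by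
      intro j'
      split_ifs <;> ring
    simp only [this, Finset.sum_add_distrib, ← Finset.sum_mul, hM]
    simp
    ring
  · simp

theorem abs_transDev_le {M : Fin k → Fin k → ℝ} (hM0 : ∀ i j, 0 ≤ M i j)
    (hM : ∀ i, ∑ j, M i j = 1) (i j i' j' : Fin k) : |transDev M i j i' j'| ≤ 1 := by
  have h0 := hM0 i j
  have h1 : M i j ≤ 1 := hM i ▸ Finset.single_le_sum (fun j _ => hM0 i j) (Finset.mem_univ j)
  unfold transDev
  split_ifs <;> rw [abs_le] <;> constructor <;> linarith

/-- Contraction towards the stationary distribution, in total variation. -/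
theorem sum_abs_sub_stationary_le {M : Fin k → Fin k → ℝ} {δ : ℝ} (hMδ : ∀ i j, δ ≤ M i j)
    (hM : ∀ i, ∑ j, M i j = 1) {π v e : Fin k → ℝ} (hπ1 : ∑ i, π i = 1)
    (hπ : ∀ j, ∑ i, π i * M i j = π j) {s : ℝ} (hv : ∑ i, v i = s)
    (he : ∀ j, |v j - ∑ i, v i * M i j| ≤ e j) :
    k * δ * ∑ j, |v j - s * π j| ≤ ∑ j, e j := by
  set w : Fin k → ℝ := fun j => v j - s * π j with hw
  have hw0 : ∑ i, w i = 0 := by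
    simp [hw, Finset.sum_sub_distrib, hv, ← Finset.mul_sum, hπ1]
  have h1 : ∀ j, |w j| ≤ e j + ∑ i, |w i| * (M i j - δ) := by
    intro j
    -- As w has total mass zero, δ may be subtracted from every entry of M; what remains is
    -- nonnegative with row sums 1 − kδ, hence contracts the ℓ¹ norm by that factor.
    have h2 : v j - ∑ i, v i * M i j = w j - ∑ i, w i * (M i j - δ) := by
      have h3 : ∑ i, w i * (M i j - δ) = ∑ i, v i * M i j - s * ∑ i, π i * M i j
          - (∑ i, w i) * δ := by
        rw [Finset.mul_sum, Finset.sum_mul, ← Finset.sum_sub_distrib, ← Finset.sum_sub_distrib]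
        exact Finset.sum_congr rfl fun i _ => by simp only [hw]; ring
      rw [h3, hw0, hπ]
      simp only [hw]
      ring
    have h3 := he j
    rw [h2] at h3
    have h4 : |∑ i, w i * (M i j - δ)| ≤ ∑ i, |w i| * (M i j - δ) := by
      refine (Finset.abs_sum_le_sum_abs _ _).trans (Finset.sum_le_sum fun i _ => ?_)
      rw [abs_mul, abs_of_nonneg (sub_nonneg.2 (hMδ i j))]
    have h5 := abs_sub_abs_le_abs_sub (w j) (∑ i, w i * (M i j - δ))
    linarith
  have h2 := Finset.sum_le_sum fun j (_ : j ∈ Finset.univ) => h1 j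
  rw [Finset.sum_add_distrib, Finset.sum_comm] at h2
  have h3 : ∑ i, ∑ j, |w i| * (M i j - δ) = (1 - k * δ) * ∑ i, |w i| := by
    rw [Finset.mul_sum]
    refine Finset.sum_congr rfl fun i _ => ?_
    rw [← Finset.mul_sum, Finset.sum_sub_distrib, hM]
    simp
    ring
  rw [h3] at h2
  linarith

end Counts

/-! ### The empirical estimator and its risk -/

open scoped Classical in
/-- The empirical transition matrix, with each row that has an entry below `δ / 2` replaced by the
uniform distribution. -/
def empiricalRow {k m : ℕ} (δ : ℝ) (x : Fin (m + 1) → Fin k) (i j : Fin k) : ℝ :=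
  if 0 < visitCount i x ∧ ∀ j, δ / 2 ≤ transCount i j x / visitCount i x then
    transCount i j x / visitCount i x else 1 / k

section Empirical

variable {k m : ℕ} {δ : ℝ}

theorem sum_empiricalRow (hk : 0 < k) (x : Fin (m + 1) → Fin k) (i : Fin k) :
    ∑ j, empiricalRow δ x i j = 1 := by
  unfold empiricalRow
  split_ifs with h
  · rw [← Finset.sum_div, sum_transCount, div_self h.1.ne']
  · have : (k : ℝ) ≠ 0 := by positivity
    simp [this]

theorem le_empiricalRow (hδ : 0 < δ) (hδk : δ < 1 / k) (x : Fin (m + 1) → Fin k)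
    (i j : Fin k) : δ / 2 ≤ empiricalRow δ x i j := by
  unfold empiricalRow
  split_ifs with h
  · exact h.2 j
  · linarith

/-- The estimator with rows `empiricalRow`. -/
def empiricalEstimator (hk : 0 < k) (hδ : 0 < δ) (hδk : δ < 1 / k) : Estimator (m + 1) k := fun x =>
  ⟨Matrix.of (empiricalRow δ x), Matrix.mem_rowStochastic_iff_sum.2
    ⟨fun i j => (half_pos hδ).le.trans (le_empiricalRow hδ hδk x i j), sum_empiricalRow hk x⟩⟩

end Empirical

section UpperBound

variable {k m : ℕ} {δ ρ : ℝ} {f : ℝ → ℝ}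

/-- The counts are invariant under M up to 1 from the endpoints and k e from the deviations; the
contraction converts this into distance from m π. -/
theorem abs_visitCount_sub_stat_le {P : MarkovModel k} (hk : 0 < k) (hδ : 0 < δ)
    (hP : ∀ i j, δ ≤ P.prob i j) {e : ℝ} {x : Fin (m + 1) → Fin k}
    (he : ∀ i j, |transSum (transDev P.prob i j) x| ≤ e) (i : Fin k) :
    |visitCount i x - m * P.stat i| ≤ (1 + k * e) / δ := by
  have h1 := sum_abs_sub_stationary_le (v := fun i => visitCount i x) (e := fun _ => 1 + k * e)
    hP P.sum_prob P.stat_mem.2 P.sum_stat_mul_prob (sum_visitCount x) fun j => by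
      have h2 := abs_visitCount_sub_le j x
      have h3 : |∑ i, transCount i j x - ∑ i, visitCount i x * P.prob i j| ≤ k * e := by
        rw [← Finset.sum_sub_distrib]
        refine (Finset.abs_sum_le_sum_abs _ _).trans ?_
        have := Finset.sum_le_sum fun i (_ : i ∈ Finset.univ) => he i j
        simp only [transSum_transDev] at this
        simpa using this
      exact (abs_sub_le _ _ _).trans (add_le_add h2 h3)
  have h2 : |visitCount i x - m * P.stat i| ≤ ∑ j, |visitCount j x - m * P.stat j| :=
    Finset.single_le_sum (f := fun j => |visitCount j x - m * P.stat j|)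
      (fun _ _ => abs_nonneg _) (Finset.mem_univ i)
  refine h2.trans ?_
  have hk' : (0 : ℝ) < k := by exact_mod_cast hk
  simp only [Finset.sum_const, Finset.card_univ, Fintype.card_fin, nsmul_eq_mul] at h1
  rw [le_div_iff₀ hδ]
  rw [mul_assoc] at h1
  have := le_of_mul_le_mul_left h1 hk'
  linarith

/-- In expectation the martingale deviations vanish, so only the endpoint error remains and the
bound is uniform in m. -/
theorem pathMean_visitCount_le {P : MarkovModel k} (hk : 0 < k) (hδ : 0 < δ)
    (hP : ∀ i j, δ ≤ P.prob i j) (i : Fin k) :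
    pathMean P.init P.prob m (visitCount i) ≤ m * P.stat i + 1 / δ := by
  set v : Fin k → ℝ := fun i => pathMean P.init P.prob m (visitCount i) with hv
  have hv1 : ∑ i, v i = m := by
    have := pathMean_sum (b := P.init) (M := P.prob) (m := m) Finset.univ
      (fun i x => visitCount i x)
    simp only [sum_visitCount] at this
    rw [hv, ← this, pathMean_const P.init_mem.2 P.sum_prob]
  have h1 := sum_abs_sub_stationary_le (v := v) (e := fun _ => 1) hP P.sum_prob P.stat_mem.2
    P.sum_stat_mul_prob hv1 fun j => by
      have h2 : ∀ i, v i * P.prob i j = pathMean P.init P.prob m (transCount i j) := by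
        intro i
        have h3 := pathMean_transSum_eq_zero (b := P.init) (m := m) (transDev P.prob i j)
          P.sum_prob (sum_mul_transDev P.sum_prob i j)
        have h4 : (transSum (transDev P.prob i j) : (Fin (m + 1) → Fin k) → ℝ) =
            fun x => transCount i j x - P.prob i j * visitCount i x := by
          funext x; rw [transSum_transDev, mul_comm]
        rw [h4, pathMean_sub, pathMean_const_mul] at h3
        simp only [hv]
        linarith
      rw [Finset.sum_congr rfl fun i _ => h2 i, ← pathMean_sum]
      simp only [hv]
      rw [← pathMean_sub, abs_le]
      constructor
      · rw [← pathMean_const (m := m) P.init_mem.2 P.sum_prob (-1)]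
        exact pathMean_mono P.init_mem.1 P.prob_nonneg fun x =>
          (abs_le.1 (abs_visitCount_sub_le j x)).1
      · rw [← pathMean_const (m := m) P.init_mem.2 P.sum_prob 1]
        exact pathMean_mono P.init_mem.1 P.prob_nonneg fun x =>
          (abs_le.1 (abs_visitCount_sub_le j x)).2
  have h2 : |v i - m * P.stat i| ≤ ∑ j, |v j - m * P.stat j| :=
    Finset.single_le_sum (f := fun j => |v j - m * P.stat j|)
      (fun _ _ => abs_nonneg _) (Finset.mem_univ i)
  have hk' : (0 : ℝ) < k := by exact_mod_cast hk
  simp only [Finset.sum_const, Finset.card_univ, Fintype.card_fin, nsmul_eq_mul] at h1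
  rw [mul_assoc] at h1
  have h3 := le_of_mul_le_mul_left h1 hk'
  have h4 : |v i - m * P.stat i| ≤ 1 / δ := by
    rw [le_div_iff₀ hδ]
    nlinarith
  linarith [(abs_le.1 h4).2]

theorem pathMean_transDev_sq_le {P : MarkovModel k} (hk : 0 < k) (hδ : 0 < δ)
    (hP : ∀ i j, δ ≤ P.prob i j) (i : Fin k) :
    pathMean P.init P.prob m
      (fun x => ∑ j, transSum (transDev P.prob i j) x ^ 2 / P.prob i j) ≤
      (k - 1) * (m * P.stat i + 1 / δ) := by
  have h1 : ∀ j, pathMean P.init P.prob m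
      (fun x => transSum (transDev P.prob i j) x ^ 2 / P.prob i j) =
      (1 - P.prob i j) * pathMean P.init P.prob m (visitCount i) := by
    intro j
    have hpos : 0 < P.prob i j := hδ.trans_le (hP i j)
    have h2 : (fun x : Fin (m + 1) → Fin k =>
        transSum (transDev P.prob i j) x ^ 2 / P.prob i j) =
        fun x => (P.prob i j)⁻¹ * transSum (transDev P.prob i j) x ^ 2 := by
      funext x; rw [div_eq_inv_mul]
    have h3 : (transSum fun i' (_ : Fin k) => P.prob i j * (1 - P.prob i j) *
        if i' = i then 1 else 0 : (Fin (m + 1) → Fin k) → ℝ) =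
        fun x => P.prob i j * (1 - P.prob i j) * visitCount i x := by
      funext x
      simp only [visitCount, transSum, Finset.mul_sum]
    rw [h2, pathMean_const_mul, pathMean_transSum_sq _ P.sum_prob
      (sum_mul_transDev P.sum_prob i j)]
    simp only [sum_mul_transDev_sq P.sum_prob]
    rw [h3, pathMean_const_mul]
    field_simp
  rw [pathMean_sum, Finset.sum_congr rfl fun j _ => h1 j, ← Finset.sum_mul,
    Finset.sum_sub_distrib, P.sum_prob]
  simp only [Finset.sum_const, Finset.card_univ, Fintype.card_fin, nsmul_eq_mul, mul_one]
  have hk' : (1 : ℝ) ≤ k := by exact_mod_cast hk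
  exact mul_le_mul_of_nonneg_left (pathMean_visitCount_le hk hδ hP i) (by linarith)

theorem IsOrdinary.exists_estimator (hf : IsOrdinary f) (hk : 0 < k) (hδ : 0 < δ)
    (hδk : δ < 1 / (k : ℝ)) (hρ : 0 < ρ) {η : ℝ} (hη0 : 0 < η) (hη1 : η ≤ 1 / 2) :
    ∃ C c : ℝ, 0 ≤ C ∧ 0 < c ∧ ∃ m₀ : ℕ, ∀ m, m₀ ≤ m → ∃ E : Estimator (m + 1) k,
      ∀ P ∈ chainClass k δ ρ, ∀ i, stateRisk (fDiv f) P E i ≤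
        (((1 + η) * (iteratedDeriv 2 f 1 / 2) / (((1 - η) * (m * P.stat i)) ^ 2) *
          ((k - 1) * (m * P.stat i + 1 / δ)) + C * Real.exp (-(c * m)) : ℝ) : EReal) := by
  have hk' : (0 : ℝ) < k := by exact_mod_cast hk
  have ha : 0 < iteratedDeriv 2 f 1 / 2 := half_pos hf.deriv_two_pos
  obtain ⟨C, hC0, hC⟩ := hf.exists_fDiv_le_const (k := k) hδ
  obtain ⟨s, hs0, hs⟩ := hf.exists_fDiv_le_quadratic (k := k) hδ hη0
  set a := iteratedDeriv 2 f 1 / 2 with hadef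
  -- Deviations up to ε m give, by the second bound and m ≥ 2/(ηρδ), visit counts within η m ρ of m
  -- π_i; by the third, empirical entries within min(s, δ/2) of the truth, as N_i ≥ m ρ / 2. The
  -- truncation of the row is then inactive.
  set ε := min 1 (min (η * ρ * δ / (2 * k)) (min s (δ / 2) * (ρ / 2))) with hε
  have hε0 : 0 < ε := by positivity
  have hε1 : ε ≤ 1 := min_le_left _ _
  have hε2 : ε ≤ η * ρ * δ / (2 * k) := (min_le_right _ _).trans (min_le_left _ _)
  have hε3 : ε ≤ min s (δ / 2) * (ρ / 2) := (min_le_right _ _).trans (min_le_right _ _)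
  obtain ⟨m₀, hm₀⟩ := exists_nat_ge (2 / (η * ρ * δ))
  refine ⟨C * (2 * k ^ 2), ε ^ 2 / 4, by positivity, by positivity, max m₀ 1, fun m hm =>
    ⟨empiricalEstimator hk hδ hδk, fun P hP i => ?_⟩⟩
  obtain ⟨hPδ, hPρ⟩ := hP
  change ∀ i j, δ ≤ P.prob i j at hPδ
  have hm1 : (1 : ℝ) ≤ m := by exact_mod_cast (le_max_right _ _).trans hm
  have hm2 : 2 / (η * ρ * δ) ≤ m := hm₀.trans (by exact_mod_cast (le_max_left _ _).trans hm)
  have hstat : ρ ≤ P.stat i := hPρ.2 ⟨i, rfl⟩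
  have hstat0 : 0 < P.stat i := hρ.trans_le hstat
  have hM0 : ∀ j, 0 < P.prob i j := fun j => hδ.trans_le (hPδ i j)
  -- A union bound over the k² pairs: off the good event this sum of indicators is at least 1 and
  -- pays for the constant C.
  let ind : Fin k × Fin k → (Fin (m + 1) → Fin k) → ℝ := fun ij x =>
    if |transSum (transDev P.prob ij.1 ij.2) x| ≤ ε * m then 0 else 1
  have hind0 : ∀ ij x, 0 ≤ ind ij x := fun ij x => by simp only [ind]; split_ifs <;> norm_num
  set A := (1 + η) * a / (((1 - η) * (m * P.stat i)) ^ 2) with hAdef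
  have hA0 : 0 ≤ A := by positivity
  have hpt : ∀ x : Fin (m + 1) → Fin k, fDiv f (P.prob i)
      ((empiricalEstimator hk hδ hδk x).1 i) ≤
      ((A * (∑ j, transSum (transDev P.prob i j) x ^ 2 / P.prob i j) +
        C * ∑ ij, ind ij x : ℝ) : EReal) := by
    intro x
    change fDiv f (P.prob i) (empiricalRow δ x i) ≤ _
    have hq := le_empiricalRow hδ hδk x i
    have hq1 := sum_empiricalRow (δ := δ) hk x i
    have hquad0 : 0 ≤ ∑ j, transSum (transDev P.prob i j) x ^ 2 / P.prob i j :=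
      Finset.sum_nonneg fun j _ => div_nonneg (sq_nonneg _) (hM0 j).le
    by_cases hgood : ∀ i j, |transSum (transDev P.prob i j) x| ≤ ε * m
    · have h1 := abs_visitCount_sub_stat_le hk hδ hPδ hgood i
      have h2 : (1 + k * (ε * m)) / δ ≤ η * (m * ρ) := by
        rw [div_le_iff₀ hδ]
        have h3 : 2 ≤ m * (η * ρ * δ) := (div_le_iff₀ (by positivity)).1 hm2
        have h4 : ε * (2 * k) ≤ η * ρ * δ := (le_div_iff₀ (by positivity)).1 hε2
        nlinarith
      have h5 : η * (m * ρ) ≤ η * (m * P.stat i) := by gcongr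
      have h6 : (1 - η) * (m * P.stat i) ≤ visitCount i x := by
        linarith [(abs_le.1 h1).1]
      have h7 : m * (ρ / 2) ≤ visitCount i x := by
        refine le_trans ?_ h6
        have : 1 / 2 * (m * ρ) ≤ (1 - η) * (m * P.stat i) := by
          apply mul_le_mul <;> first | linarith | gcongr | positivity
        linarith
      have h8 : 0 < visitCount i x := lt_of_lt_of_le (by positivity) h7
      have h9 : ∀ j, transCount i j x / visitCount i x - P.prob i j =
          transSum (transDev P.prob i j) x / visitCount i x := by
        intro j
        rw [transSum_transDev]
        field_simp
      have h10 : ∀ j, |transCount i j x / visitCount i x - P.prob i j| ≤ min s (δ / 2) := by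
        intro j
        rw [h9, abs_div, abs_of_pos h8, div_le_iff₀ h8]
        calc _ ≤ ε * m := hgood i j
          _ ≤ min s (δ / 2) * (ρ / 2) * m := by gcongr
          _ = min s (δ / 2) * (m * (ρ / 2)) := by ring
          _ ≤ _ := by gcongr
      have h11 : empiricalRow δ x i = fun j => transCount i j x / visitCount i x := by
        funext j
        rw [empiricalRow, if_pos]
        refine ⟨h8, fun j => ?_⟩
        have := (abs_le.1 ((h10 j).trans (min_le_right _ _))).1
        linarith [hPδ i j]
      have h12 := hs (P.prob i) (empiricalRow δ x i) (P.sum_prob i) hq1 (hPδ i) hq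
        (fun j => by rw [h11]; exact (h10 j).trans (min_le_left _ _))
      refine h12.trans ?_
      rw [EReal.coe_le_coe_iff, h11]
      have h13 : ∀ j, (transCount i j x / visitCount i x - P.prob i j) ^ 2 / P.prob i j ≤
          1 / ((1 - η) * (m * P.stat i)) ^ 2 *
            (transSum (transDev P.prob i j) x ^ 2 / P.prob i j) := by
        intro j
        rw [h9, div_pow]
        have hpos : 0 < (1 - η) * (m * P.stat i) :=
          mul_pos (by linarith) (by positivity)
        have h14 : 1 / visitCount i x ^ 2 ≤ 1 / ((1 - η) * (m * P.stat i)) ^ 2 := by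
          gcongr
        have h15 : 0 ≤ transSum (transDev P.prob i j) x ^ 2 / P.prob i j :=
          div_nonneg (sq_nonneg _) (hM0 j).le
        calc _ = 1 / visitCount i x ^ 2 *
              (transSum (transDev P.prob i j) x ^ 2 / P.prob i j) := by ring
          _ ≤ _ := mul_le_mul_of_nonneg_right h14 h15
      have h14 := Finset.sum_le_sum fun j (_ : j ∈ Finset.univ) => h13 j
      rw [← Finset.mul_sum] at h14
      have h15 := mul_le_mul_of_nonneg_left h14 (by positivity : 0 ≤ (1 + η) * a)
      have h16 : 0 ≤ C * ∑ ij, ind ij x :=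
        mul_nonneg hC0 (Finset.sum_nonneg fun _ _ => hind0 _ _)
      have h17 : (1 + η) * a * (1 / ((1 - η) * (m * P.stat i)) ^ 2 *
          ∑ j, transSum (transDev P.prob i j) x ^ 2 / P.prob i j) =
          A * ∑ j, transSum (transDev P.prob i j) x ^ 2 / P.prob i j := by
        rw [hAdef]; ring
      linarith
    · push Not at hgood
      obtain ⟨i', j', hij⟩ := hgood
      refine (hC (P.prob i) _ (P.sum_prob i) hq1 (hPδ i) hq).trans ?_
      rw [EReal.coe_le_coe_iff]
      have h1 : 1 ≤ ∑ ij, ind ij x := by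
        have h2 : ind (i', j') x = 1 := by simp only [ind]; rw [if_neg (not_le.2 hij)]
        rw [← h2]
        exact Finset.single_le_sum (f := fun ij => ind ij x) (fun _ _ => hind0 _ _)
          (Finset.mem_univ (i', j'))
      nlinarith [mul_nonneg hA0 hquad0]
  refine (stateRisk_le_pathMean hpt).trans ?_
  rw [EReal.coe_le_coe_iff, pathMean_add, pathMean_const_mul, pathMean_const_mul,
    pathMean_sum Finset.univ ind]
  have h1 := mul_le_mul_of_nonneg_left (pathMean_transDev_sq_le (m := m) hk hδ hPδ i) hA0
  have h2 : ∀ ij, pathMean P.init P.prob m (ind ij) ≤ 2 * Real.exp (-(ε ^ 2 / 4 * m)) :=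
    fun ij => pathMean_indicator_le _ P.init_mem.1 P.prob_nonneg P.init_mem.2 P.sum_prob
      (sum_mul_transDev P.sum_prob _ _) (abs_transDev_le P.prob_nonneg P.sum_prob _ _) hε0 hε1
  have h3 := mul_le_mul_of_nonneg_left (Finset.sum_le_sum fun ij (_ : ij ∈ Finset.univ) => h2 ij)
    hC0
  simp only [Finset.sum_const, Finset.card_univ, Fintype.card_prod, Fintype.card_fin,
    nsmul_eq_mul, Nat.cast_mul] at h3
  refine add_le_add h1 (h3.trans (le_of_eq ?_))
  ring

end UpperBound

/-! ### Asymptotic upper bounds -/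

section UpperAsymptotics

variable {k : ℕ} {δ ρ : ℝ} {f : ℝ → ℝ}

theorem AsympLE.of_forall_eventually {a : ℕ → EReal} {b : ℕ → ℝ} (hb : ∀ᶠ n in atTop, 0 < b n)
    (h : ∀ η : ℝ, 0 < η → ∀ᶠ n in atTop, a n ≤ ((b n * (1 + η) : ℝ) : EReal)) :
    AsympLE a fun n => (b n : EReal) := by
  -- The error term is the relative excess of a over b; its positive part needs no lower bound on a.
  refine ⟨fun n => max 0 ((a n).toReal / b n - 1), ?_, ?_⟩
  · rw [Metric.tendsto_atTop']
    intro e he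
    obtain ⟨N, hN⟩ := eventually_atTop.1 (hb.and (h (e / 2) (by positivity)))
    refine ⟨N, fun n hn => ?_⟩
    obtain ⟨hbn, han⟩ := hN n hn.le
    rw [Real.dist_eq, sub_zero, abs_of_nonneg (le_max_left _ _)]
    refine max_lt he ?_
    have h1 : (a n).toReal ≤ b n * (1 + e / 2) := by
      rcases eq_or_ne (a n) ⊥ with h0 | h0
      · rw [h0, EReal.toReal_bot]; positivity
      · exact EReal.toReal_le_toReal han h0 (EReal.coe_ne_top _)
    have h2 : (a n).toReal / b n ≤ 1 + e / 2 := by rw [div_le_iff₀ hbn]; linarith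
    linarith
  · filter_upwards [hb, h 1 one_pos] with n hbn han
    have htop : a n ≠ ⊤ := (han.trans_lt (EReal.coe_lt_top _)).ne
    refine (EReal.le_coe_toReal htop).trans ?_
    rw [← EReal.coe_mul, EReal.coe_le_coe_iff]
    have h1 : (a n).toReal / b n - 1 ≤ max 0 ((a n).toReal / b n - 1) := le_max_right _ _
    calc (a n).toReal = b n * (1 + ((a n).toReal / b n - 1)) := by field_simp; ring
      _ ≤ _ := by gcongr

theorem MarkovModel.stat_le_one (P : MarkovModel k) (i : Fin k) : P.stat i ≤ 1 :=
  P.stat_mem.2 ▸ Finset.single_le_sum (fun j _ => P.stat_mem.1 j) (Finset.mem_univ i)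

theorem IsOrdinary.eventually_exists_estimator (hf : IsOrdinary f) (hk : 2 ≤ k) (hδ : 0 < δ)
    (hδk : δ < 1 / (k : ℝ)) (hρ : 0 < ρ) {η : ℝ} (hη : 0 < η) :
    ∀ᶠ n in atTop, ∃ E : Estimator n k, ∀ P ∈ chainClass k δ ρ, ∀ i, stateRisk (fDiv f) P E i ≤
        (((k - 1) * (iteratedDeriv 2 f 1 / 2) * (1 + η) / (n * P.stat i) : ℝ) : EReal) := by
  have ha : 0 < iteratedDeriv 2 f 1 / 2 := half_pos hf.deriv_two_pos
  -- With this ζ, (1 + η)(1 − 2ζ) − (1 + ζ) = ζ > 0, whence (1 + ζ)/(1 − ζ)² < 1 + η.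
  set ζ := η / (4 + 2 * η) with hζ
  have hζ0 : 0 < ζ := by positivity
  have hζη : ζ * (4 + 2 * η) = η := by rw [hζ]; field_simp
  have hζ1 : ζ ≤ 1 / 2 := by rw [hζ, div_le_div_iff₀ (by positivity) (by norm_num)]; linarith
  obtain ⟨C, c, hC, hc, m₀, hE⟩ := hf.exists_estimator (by omega : 0 < k) hδ hδk hρ hζ0 hζ1
  set a := iteratedDeriv 2 f 1 / 2 with hadef
  have hk1 : (0 : ℝ) < k - 1 := by
    have : (2 : ℝ) ≤ k := by exact_mod_cast hk
    linarith
  set κ := (1 + ζ) / (1 - ζ) ^ 2 with hκ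
  have h1ζ : 0 < 1 - ζ := by linarith
  have hκη : κ < 1 + η := by
    rw [hκ, div_lt_iff₀ (by positivity)]
    nlinarith [mul_pos hη (mul_pos hζ0 hζ0)]
  have hκ0 : 0 < κ := by positivity
  -- This is the risk bound times n π_i, made uniform in the chain by ρ ≤ π_i ≤ 1; the factor 1 +
  -- 1/m reflects n = m + 1 samples against m transitions.
  have hlim : Tendsto (fun m : ℕ => (1 + 1 / (m : ℝ)) * (κ * a * (k - 1)) *
      (1 + 1 / (δ * ρ) * (1 / (m : ℝ))) + C * ((m + 1) * Real.exp (-(c * m)))) atTop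
      (𝓝 ((1 + 0) * (κ * a * (k - 1)) * (1 + 1 / (δ * ρ) * 0) + C * 0)) := by
    have h0 : Tendsto (fun m : ℕ => 1 / (m : ℝ)) atTop (𝓝 0) := tendsto_one_div_atTop_nhds_zero_nat
    have h1 : Tendsto (fun x : ℝ => (x + 1) * Real.exp (-(c * x))) atTop (𝓝 0) := by
      have h2 : Tendsto (fun x : ℝ => x ^ (1 : ℝ) * Real.exp (-c * x)) atTop (𝓝 0) :=
        tendsto_rpow_mul_exp_neg_mul_atTop_nhds_zero 1 c hc
      have h3 : Tendsto (fun x : ℝ => x ^ (0 : ℝ) * Real.exp (-c * x)) atTop (𝓝 0) :=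
        tendsto_rpow_mul_exp_neg_mul_atTop_nhds_zero 0 c hc
      have := h2.add h3
      simp only [add_zero, Real.rpow_one, Real.rpow_zero] at this
      refine this.congr fun x => ?_
      rw [neg_mul]
      ring
    exact (((h0.const_add 1).mul_const _).mul ((h0.const_mul _).const_add 1)).add
      ((h1.comp tendsto_natCast_atTop_atTop).const_mul C)
  have hlt : (1 + 0) * (κ * a * (k - 1)) * (1 + 1 / (δ * ρ) * 0) + C * 0 <
      (k - 1) * a * (1 + η) := by
    have := mul_lt_mul_of_pos_right hκη (mul_pos hk1 ha)
    linarith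
  obtain ⟨N, hN⟩ := eventually_atTop.1 (hlim.eventually_lt_const hlt)
  refine eventually_atTop.2 ⟨max (max N m₀) 1 + 1, fun n hn => ?_⟩
  obtain ⟨m, rfl⟩ : ∃ m, n = m + 1 := ⟨n - 1, by omega⟩
  have hm : max (max N m₀) 1 ≤ m := by omega
  have hm1 : (1 : ℝ) ≤ m := by exact_mod_cast (le_max_right _ _).trans hm
  have hm0 : (0 : ℝ) < m := by linarith
  have hNm := hN m ((le_max_left _ _).trans ((le_max_left _ _).trans hm))
  obtain ⟨E, hE⟩ := hE m ((le_max_right _ _).trans ((le_max_left _ _).trans hm))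
  refine ⟨E, fun P hP i => (hE P hP i).trans ?_⟩
  rw [EReal.coe_le_coe_iff]
  have hπρ : ρ ≤ P.stat i := hP.2.2 ⟨i, rfl⟩
  have hπ1 := P.stat_le_one i
  set π := P.stat i
  have hπ0 : 0 < π := hρ.trans_le hπρ
  push_cast
  rw [le_div_iff₀ (by positivity), add_mul]
  refine le_trans (add_le_add ?_ ?_) hNm.le
  · have h1 : (1 + ζ) * a / ((1 - ζ) * (m * π)) ^ 2 * ((k - 1) * (m * π + 1 / δ)) *
        ((m + 1) * π) = (1 + 1 / (m : ℝ)) * (κ * a * (k - 1)) * (1 + 1 / (δ * π) * (1 / m)) := by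
      rw [hκ]
      field_simp
    rw [h1]
    have h2 : 1 / (δ * π) ≤ 1 / (δ * ρ) := by gcongr
    gcongr
  · calc C * Real.exp (-(c * m)) * ((m + 1) * π) = C * ((m + 1) * Real.exp (-(c * m))) * π := by
          ring
      _ ≤ C * ((m + 1) * Real.exp (-(c * m))) * 1 := by gcongr
      _ = _ := mul_one _

theorem IsOrdinary.minimaxWorst_asympLE (hf : IsOrdinary f) (hk : 2 ≤ k) (hδ : 0 < δ)
    (hδk : δ < 1 / (k : ℝ)) (hρ : 0 < ρ) :
    AsympLE (minimaxWorst (fDiv f) (chainClass k δ ρ))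
      (fun n => ((((k : ℝ) - 1) * iteratedDeriv 2 f 1 / (2 * n * ρ) : ℝ) : EReal)) := by
  have ha := hf.deriv_two_pos
  have hk1 : (0 : ℝ) < k - 1 := by
    have : (2 : ℝ) ≤ k := by exact_mod_cast hk
    linarith
  refine AsympLE.of_forall_eventually ?_ fun η hη => ?_
  · filter_upwards [eventually_gt_atTop 0] with n hn
    have : (0 : ℝ) < n := by exact_mod_cast hn
    positivity
  filter_upwards [hf.eventually_exists_estimator hk hδ hδk hρ hη, eventually_gt_atTop 0] with n hE hn
  have hn0 : (0 : ℝ) < n := by exact_mod_cast hn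
  obtain ⟨E, hE⟩ := hE
  refine (iInf_le _ E).trans (iSup₂_le fun P hP => iSup_le fun i => (hE P hP i).trans ?_)
  rw [EReal.coe_le_coe_iff]
  have hπ : ρ ≤ P.stat i := hP.2.2 ⟨i, rfl⟩
  calc ((k : ℝ) - 1) * (iteratedDeriv 2 f 1 / 2) * (1 + η) / (n * P.stat i)
      ≤ (k - 1) * (iteratedDeriv 2 f 1 / 2) * (1 + η) / (n * ρ) := by gcongr
    _ = _ := by field_simp

theorem IsOrdinary.minimaxWeighted_asympLE (hf : IsOrdinary f) (hk : 2 ≤ k) (hδ : 0 < δ)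
    (hδk : δ < 1 / (k : ℝ)) (hρ : 0 < ρ) :
    AsympLE (minimaxWeighted (fDiv f) (chainClass k δ ρ))
      (fun n => ((((k : ℝ) - 1) * k * iteratedDeriv 2 f 1 / (2 * n) : ℝ) : EReal)) := by
  have ha := hf.deriv_two_pos
  have hk1 : (0 : ℝ) < k - 1 := by
    have : (2 : ℝ) ≤ k := by exact_mod_cast hk
    linarith
  have hk0 : (0 : ℝ) < k := by linarith
  refine AsympLE.of_forall_eventually ?_ fun η hη => ?_
  · filter_upwards [eventually_gt_atTop 0] with n hn
    have : (0 : ℝ) < n := by exact_mod_cast hn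
    positivity
  filter_upwards [hf.eventually_exists_estimator hk hδ hδk hρ hη, eventually_gt_atTop 0] with n hE hn
  have hn0 : (0 : ℝ) < n := by exact_mod_cast hn
  obtain ⟨E, hE⟩ := hE
  refine (iInf_le _ E).trans (iSup₂_le fun P hP => ?_)
  have h1 : ∀ i, (P.stat i : EReal) * stateRisk (fDiv f) P E i ≤
      (((k - 1) * (iteratedDeriv 2 f 1 / 2) * (1 + η) / n : ℝ) : EReal) := by
    intro i
    have hπ : 0 < P.stat i := hρ.trans_le (hP.2.2 ⟨i, rfl⟩)
    refine (mul_le_mul_of_nonneg_left (hE P hP i) (by exact_mod_cast hπ.le)).trans (le_of_eq ?_)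
    rw [← EReal.coe_mul]
    congr 1
    field_simp
  refine (Finset.sum_le_sum fun i _ => h1 i).trans ?_
  rw [← EReal.coe_sum_finset, EReal.coe_le_coe_iff]
  simp only [Finset.sum_const, Finset.card_univ, Fintype.card_fin, nsmul_eq_mul]
  refine le_of_eq ?_
  field_simp

end UpperAsymptotics

/-! ### The van Trees inequality along a line of chains -/

section VanTrees

variable {k m : ℕ} {b : Fin k → ℝ}

/-- The score of a path is the sum of the scores H/M of its transitions; the initial law does not
depend on t. -/
theorem hasDerivAt_pathWeight {A H : Fin k → Fin k → ℝ} {t : ℝ}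
    (hM : ∀ i j, A i j + t * H i j ≠ 0) (x : Fin (m + 1) → Fin k) :
    HasDerivAt (fun t => pathWeight b (fun i j => A i j + t * H i j) m x)
      (pathWeight b (fun i j => A i j + t * H i j) m x *
        transSum (fun i j => H i j / (A i j + t * H i j)) x) t := by
  unfold pathWeight transSum
  have h1 : ∀ s ∈ (Finset.univ : Finset (Fin m)), HasDerivAt
      (fun t => A (x s.castSucc) (x s.succ) + t * H (x s.castSucc) (x s.succ))
      (H (x s.castSucc) (x s.succ)) t := fun s _ => by
    simpa using ((hasDerivAt_id t).mul_const (H (x s.castSucc) (x s.succ))).const_add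
      (A (x s.castSucc) (x s.succ))
  refine ((HasDerivAt.fun_finsetProd h1).const_mul (b (x 0))).congr_deriv ?_
  rw [mul_assoc]
  congr 1
  rw [Finset.mul_sum]
  refine Finset.sum_congr rfl fun s _ => ?_
  rw [← Finset.mul_prod_erase Finset.univ (fun s : Fin m => A (x s.castSucc) (x s.succ) +
    t * H (x s.castSucc) (x s.succ)) (Finset.mem_univ s), smul_eq_mul]
  have := hM (x s.castSucc) (x s.succ)
  field_simp

theorem integral_quartic {e : ℝ} : ∫ t in (-e)..e, (e ^ 2 - t ^ 2) ^ 2 = 16 * e ^ 5 / 15 := by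
  have : ∀ t : ℝ, (e ^ 2 - t ^ 2) ^ 2 = e ^ 4 - 2 * e ^ 2 * t ^ 2 + t ^ 4 := fun t => by ring
  simp only [this]
  rw [intervalIntegral.integral_add (by apply Continuous.intervalIntegrable; fun_prop)
    (by apply Continuous.intervalIntegrable; fun_prop),
    intervalIntegral.integral_sub (by apply Continuous.intervalIntegrable; fun_prop)
    (by apply Continuous.intervalIntegrable; fun_prop), intervalIntegral.integral_const_mul]
  simp only [intervalIntegral.integral_const, integral_pow, smul_eq_mul]
  norm_num
  ring

/-- The van Trees inequality for an entry that is affine in the parameter, with the prior density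
proportional to `(e ^ 2 - t ^ 2) ^ 2`. -/
theorem van_trees {A H : Fin k → Fin k → ℝ} {e I c h : ℝ} (he : 0 < e) (hh : 0 ≤ h)
    (hb0 : ∀ i, 0 ≤ b i) (hb : ∑ i, b i = 1) (hA : ∀ i, ∑ j, A i j = 1)
    (hH : ∀ i, ∑ j, H i j = 0) (hM : ∀ t ∈ Icc (-e) e, ∀ i j, 0 < A i j + t * H i j)
    (hI : 0 ≤ I)
    (hI0 : ∀ t ∈ Icc (-e) e, ∑ i, b i * ∑ j, H i j ^ 2 / (A i j + t * H i j) ≤ I)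
    (hI1 : ∀ t ∈ Icc (-e) e, ∀ i, ∑ l, (A i l + t * H i l) *
      ∑ j, H l j ^ 2 / (A l j + t * H l j) ≤ I) (T : (Fin (m + 1) → Fin k) → ℝ) :
    h ^ 2 / (m * I + 10 / e ^ 2) ≤
      ∫ t in (-e)..e, 15 / (16 * e ^ 5) * (e ^ 2 - t ^ 2) ^ 2 *
        pathMean b (fun i j => A i j + t * H i j) m (fun x => (T x - (c + t * h)) ^ 2) := by
  set M : ℝ → Fin k → Fin k → ℝ := fun t i j => A i j + t * H i j with hMdef
  set G : ℝ → ℝ := fun t => pathMean b (M t) m (fun x => (T x - (c + t * h)) ^ 2) with hG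
  have hMs : ∀ t i, ∑ j, M t i j = 1 := fun t i => by
    simp [hMdef, Finset.sum_add_distrib, ← Finset.mul_sum, hA, hH]
  set K := m * I + 10 / e ^ 2 with hK
  have hK0 : 0 < K := by positivity
  -- The Cauchy–Schwarz step of van Trees in the form xy ≤ s x²/2 + y²/(2s), with s left free so
  -- that it can be applied pointwise under the integral.
  have key : ∀ s : ℝ, 0 < s → 0 ≤ ∫ t in (-e)..e, (s / 2 * ((e ^ 2 - t ^ 2) ^ 2 * G t) +
      (2 * s)⁻¹ * ((e ^ 2 - t ^ 2) ^ 2 * (m * I) + 16 * t ^ 2) - h * (e ^ 2 - t ^ 2) ^ 2) := by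
    intro s hs
    -- The mean error times the unnormalised prior. It vanishes at ±e, and its derivative contains
    -- −h times the prior, which is the term to be bounded.
    set F : ℝ → ℝ := fun t =>
      ∑ x, pathWeight b (M t) m x * ((T x - (c + t * h)) * (e ^ 2 - t ^ 2) ^ 2) with hF
    have hF0 : F e - F (-e) = 0 := by simp [hF]
    rw [← hF0]
    have hder : ∀ t ∈ Icc (-e) e, HasDerivAt F (∑ x, (pathWeight b (M t) m x *
        transSum (fun i j => H i j / M t i j) x * ((T x - (c + t * h)) * (e ^ 2 - t ^ 2) ^ 2) +
        pathWeight b (M t) m x * (-h * (e ^ 2 - t ^ 2) ^ 2 +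
          (T x - (c + t * h)) * (-4 * t * (e ^ 2 - t ^ 2))))) t := by
      intro t ht
      refine HasDerivAt.fun_sum fun x _ => ?_
      refine (hasDerivAt_pathWeight (fun i j => (hM t ht i j).ne') x).mul ?_
      have h1 : HasDerivAt (fun t => T x - (c + t * h)) (-h) t := by
        simpa using (((hasDerivAt_id t).mul_const h).const_add c).const_sub (T x)
      have h2 : HasDerivAt (fun t => (e ^ 2 - t ^ 2) ^ 2) (-4 * t * (e ^ 2 - t ^ 2)) t := by
        refine (((hasDerivAt_pow 2 t).const_sub (e ^ 2)).fun_pow 2).congr_deriv ?_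
        simp only [Nat.cast_ofNat, Nat.add_one_sub_one, pow_one]
        ring
      exact h1.mul h2
    refine intervalIntegral.sub_le_integral_of_hasDeriv_right_of_le (by linarith)
      (fun t ht => (hder t ht).continuousAt.continuousWithinAt)
      (fun t ht => (hder t (Ioo_subset_Icc_self ht)).hasDerivWithinAt) ?_ fun t ht => ?_
    · refine ContinuousOn.integrableOn_Icc (Continuous.continuousOn ?_)
      simp only [hG, pathMean, pathWeight, hMdef]
      fun_prop
    · have ht' := Ioo_subset_Icc_self ht
      set u := e ^ 2 - t ^ 2 with hu
      set S : (Fin (m + 1) → Fin k) → ℝ := transSum fun i j => H i j / M t i j with hS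
      have hMt0 : ∀ i j, 0 < M t i j := hM t ht'
      have hMt : ∀ i j, 0 ≤ M t i j := fun i j => (hMt0 i j).le
      have hscore : ∀ i, ∑ j, M t i j * (H i j / M t i j) = 0 := fun i => by
        rw [← hH i]
        refine Finset.sum_congr rfl fun j _ => ?_
        have := (hMt0 i j).ne'
        field_simp
      have hS0 : pathMean b (M t) m S = 0 := pathMean_transSum_eq_zero _ (hMs t) hscore
      have hS2 : pathMean b (M t) m (fun x => S x ^ 2) ≤ m * I := by
        rw [hS, pathMean_transSum_sq _ (hMs t) hscore]
        have h1 : ∀ i, ∑ j, M t i j * (H i j / M t i j) ^ 2 =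
            ∑ j, H i j ^ 2 / M t i j := fun i => by
          refine Finset.sum_congr rfl fun j _ => ?_
          have := (hMt0 i j).ne'
          field_simp
        simp only [h1]
        exact pathMean_transSum_le hb0 hMt hb (hMs t) _ (hI0 t ht') (hI1 t ht')
      -- The two factors are u times the error and u S − 4 t, the score of the path together with
      -- the prior. After averaging, E S = 0 removes the cross term of the latter's square.
      have h1 : ∀ x, S x * ((T x - (c + t * h)) * u ^ 2) + (-h * u ^ 2 +
          (T x - (c + t * h)) * (-4 * t * u)) ≤ s / 2 * (u ^ 2 * (T x - (c + t * h)) ^ 2) +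
          (2 * s)⁻¹ * (u ^ 2 * S x ^ 2 + -8 * t * u * S x + 16 * t ^ 2) + -h * u ^ 2 := by
        intro x
        have h2 : 0 ≤ (s * (u * (T x - (c + t * h))) - (u * S x - 4 * t)) ^ 2 * (2 * s)⁻¹ := by
          positivity
        have h3 : (s * (u * (T x - (c + t * h))) - (u * S x - 4 * t)) ^ 2 * (2 * s)⁻¹ =
            s / 2 * (u ^ 2 * (T x - (c + t * h)) ^ 2) -
            (u * (T x - (c + t * h))) * (u * S x - 4 * t) +
            (2 * s)⁻¹ * (u ^ 2 * S x ^ 2 + -8 * t * u * S x + 16 * t ^ 2) := by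
          field_simp
          ring
        linarith
      have h2 := pathMean_mono (m := m) hb0 hMt h1
      calc _ = pathMean b (M t) m (fun x => S x * ((T x - (c + t * h)) * u ^ 2) + (-h * u ^ 2 +
            (T x - (c + t * h)) * (-4 * t * u))) :=
            Finset.sum_congr rfl fun x _ => by ring
        _ ≤ _ := h2
        _ = s / 2 * (u ^ 2 * G t) + (2 * s)⁻¹ * (u ^ 2 * pathMean b (M t) m (fun x => S x ^ 2) +
            -8 * t * u * pathMean b (M t) m S + 16 * t ^ 2) + -h * u ^ 2 := by
            simp only [pathMean_add, pathMean_const_mul, pathMean_const hb (hMs t), hG]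
        _ ≤ _ := by
            rw [hS0, mul_zero, add_zero]
            have := mul_le_mul_of_nonneg_left hS2 (sq_nonneg u)
            have h4 : (2 * s)⁻¹ * (u ^ 2 * pathMean b (M t) m (fun x => S x ^ 2) + 16 * t ^ 2) ≤
                (2 * s)⁻¹ * (u ^ 2 * (m * I) + 16 * t ^ 2) := by gcongr
            linarith
  have hGc : Continuous G := by
    simp only [hG, pathMean, pathWeight, hMdef]
    fun_prop
  have hV : ∫ t in (-e)..e, t ^ 2 = 2 * e ^ 3 / 3 := by
    rw [integral_pow]
    norm_num
    ring
  set X := ∫ t in (-e)..e, (e ^ 2 - t ^ 2) ^ 2 * G t with hX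
  have hXeq : ∫ t in (-e)..e, 15 / (16 * e ^ 5) * (e ^ 2 - t ^ 2) ^ 2 * G t =
      15 / (16 * e ^ 5) * X := by
    rw [hX, ← intervalIntegral.integral_const_mul]
    exact intervalIntegral.integral_congr fun t _ => by ring
  have key2 : ∀ s : ℝ, 0 < s → h * (16 * e ^ 5 / 15) ≤ s / 2 * X +
      (2 * s)⁻¹ * (16 * e ^ 5 / 15 * K) := by
    intro s hs
    have h1 := key s hs
    rw [intervalIntegral.integral_sub (by apply Continuous.intervalIntegrable; fun_prop)
      (by apply Continuous.intervalIntegrable; fun_prop),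
      intervalIntegral.integral_add (by apply Continuous.intervalIntegrable; fun_prop)
      (by apply Continuous.intervalIntegrable; fun_prop), intervalIntegral.integral_const_mul,
      intervalIntegral.integral_const_mul, intervalIntegral.integral_const_mul,
      intervalIntegral.integral_add (by apply Continuous.intervalIntegrable; fun_prop)
      (by apply Continuous.intervalIntegrable; fun_prop), intervalIntegral.integral_mul_const,
      intervalIntegral.integral_const_mul, integral_quartic, hV, ← hX] at h1
    -- The term 10/e² in K is the Fisher information of the prior: ∫ 16 t² divided by the mass 16
    -- e⁵/15.
    have h2 : 16 * e ^ 5 / 15 * (m * I) + 16 * (2 * e ^ 3 / 3) = 16 * e ^ 5 / 15 * K := by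
      rw [hK]; field_simp; ring
    rw [h2] at h1
    linarith
  have hX0 : 0 ≤ X := by
    refine intervalIntegral.integral_nonneg (by linarith) fun t ht => mul_nonneg (sq_nonneg _) ?_
    exact Finset.sum_nonneg fun x _ => mul_nonneg
      (pathWeight_nonneg hb0 (fun i j => (hM t ht i j).le) x) (sq_nonneg _)
  rw [hXeq]
  rcases hh.eq_or_lt with h0 | h0
  · rw [← h0, zero_pow two_ne_zero, zero_div]
    positivity
  -- The choice s = K/h makes the second term exactly half of the left side.
  have h1 := key2 (K / h) (by positivity)
  have h2 : (2 * (K / h))⁻¹ * (16 * e ^ 5 / 15 * K) = h / 2 * (16 * e ^ 5 / 15) := by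
    field_simp
  rw [h2] at h1
  have h3 : h * (16 * e ^ 5 / 15) / 2 * (2 * h / K * (15 / (16 * e ^ 5))) ≤
      K / h / 2 * X * (2 * h / K * (15 / (16 * e ^ 5))) :=
    mul_le_mul_of_nonneg_right (by linarith) (by positivity)
  have h4 : h * (16 * e ^ 5 / 15) / 2 * (2 * h / K * (15 / (16 * e ^ 5))) = h ^ 2 / K := by
    field_simp
  have h5 : K / h / 2 * X * (2 * h / K * (15 / (16 * e ^ 5))) = 15 / (16 * e ^ 5) * X := by
    field_simp
  linarith

end VanTrees

/-! ### Averaging over a product prior -/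

section ProductPrior

open MeasureTheory

/-- Resampling one coordinate preserves a product measure. -/
theorem measurePreserving_update_pi {ι : Type*} [Fintype ι] [DecidableEq ι] (ν : Measure ℝ)
    [IsProbabilityMeasure ν] (a : ι) :
    MeasurePreserving (fun p : (ι → ℝ) × ℝ => Function.update p.1 a p.2)
      ((Measure.pi fun _ => ν).prod ν) (Measure.pi fun _ => ν) := by
  refine ⟨measurable_update', ?_⟩
  symm
  refine Measure.pi_eq fun s hs => ?_
  rw [Measure.map_apply measurable_update' (MeasurableSet.univ_pi hs)]
  have h1 : (fun p : (ι → ℝ) × ℝ => Function.update p.1 a p.2) ⁻¹' univ.pi s =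
      (univ.pi (Function.update s a univ)) ×ˢ s a := by
    ext ⟨x, t⟩
    simp only [mem_preimage, mem_univ_pi, mem_prod]
    constructor
    · intro h
      refine ⟨fun i => ?_, by simpa using h a⟩
      rcases eq_or_ne i a with rfl | hi
      · simp
      · simpa [hi] using h i
    · rintro ⟨h, ht⟩ i
      rcases eq_or_ne i a with rfl | hi
      · simpa using ht
      · simpa [hi] using h i
  rw [h1, Measure.prod_prod, Measure.pi_pi, ← Finset.mul_prod_erase _ _ (Finset.mem_univ a),
    ← Finset.mul_prod_erase Finset.univ (fun i => ν (s i)) (Finset.mem_univ a)]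
  simp only [Function.update_self, measure_univ, one_mul]
  rw [mul_comm]
  congr 1
  refine Finset.prod_congr rfl fun i hi => ?_
  rw [Function.update_of_ne (Finset.ne_of_mem_erase hi)]

/-- The prior with density proportional to `(e ^ 2 - t ^ 2) ^ 2` on `[-e, e]`. -/
def quarticPrior (e : ℝ) : Measure ℝ :=
  (volume.restrict (Ioc (-e) e)).withDensity fun t =>
    ENNReal.ofReal (15 / (16 * e ^ 5) * (e ^ 2 - t ^ 2) ^ 2)

theorem integral_quarticPrior {e : ℝ} (he : 0 < e) (g : ℝ → ℝ) :
    ∫ t, g t ∂quarticPrior e =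
      ∫ t in (-e)..e, 15 / (16 * e ^ 5) * (e ^ 2 - t ^ 2) ^ 2 * g t := by
  rw [quarticPrior, integral_withDensity_eq_integral_toReal_smul (by fun_prop)
    (ae_of_all _ fun _ => ENNReal.ofReal_lt_top), intervalIntegral.integral_of_le (by linarith)]
  refine integral_congr_ae (ae_of_all _ fun t => ?_)
  simp only [smul_eq_mul]
  rw [ENNReal.toReal_ofReal (by positivity)]

theorem isProbabilityMeasure_quarticPrior {e : ℝ} (he : 0 < e) :
    IsProbabilityMeasure (quarticPrior e) := by
  refine ⟨?_⟩
  rw [quarticPrior, withDensity_apply _ MeasurableSet.univ, Measure.restrict_univ,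
    ← ofReal_integral_eq_lintegral_ofReal, ← intervalIntegral.integral_of_le (by linarith),
    intervalIntegral.integral_const_mul, integral_quartic]
  · rw [ENNReal.ofReal_eq_one]
    field_simp
  · exact (Continuous.integrableOn_Ioc (by fun_prop))
  · exact ae_of_all _ fun t => by positivity

theorem ae_quarticPrior (e : ℝ) : ∀ᵐ t ∂quarticPrior e, t ∈ Icc (-e) e := by
  refine (withDensity_absolutelyContinuous _ _).ae_le ?_
  filter_upwards [ae_restrict_mem measurableSet_Ioc] with t ht using Ioc_subset_Icc_self ht

/-- If each of finitely many functions has large mean over each coordinate line through the box,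
then a weighted sum of them cannot be small on the whole box. -/
theorem sum_le_of_forall_line {ι : Type*} [Fintype ι] [DecidableEq ι] {e : ℝ} (he : 0 < e)
    {G : ι → (ι → ℝ) → ℝ} (hG : ∀ a, Continuous (G a)) {w L : ι → ℝ} (hw : ∀ a, 0 ≤ w a) {B : ℝ}
    (hL : ∀ a θ, (∀ i, θ i ∈ Icc (-e) e) → L a ≤
      ∫ t in (-e)..e, 15 / (16 * e ^ 5) * (e ^ 2 - t ^ 2) ^ 2 * G a (Function.update θ a t))
    (hB : ∀ θ : ι → ℝ, (∀ i, θ i ∈ Icc (-e) e) → ∑ a, w a * G a θ ≤ B) :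
    ∑ a, w a * L a ≤ B := by
  have := isProbabilityMeasure_quarticPrior he
  set μ : Measure (ι → ℝ) := Measure.pi fun _ => quarticPrior e with hμ
  have hbox : ∀ᵐ θ ∂μ, ∀ i, θ i ∈ Icc (-e) e :=
    eventually_all.2 fun i => Measure.tendsto_eval_ae_ae.eventually (ae_quarticPrior e)
  have hint : ∀ a, Integrable (G a) μ := by
    intro a
    obtain ⟨C, hC⟩ := (isCompact_univ_pi fun _ : ι => isCompact_Icc (a := -e)
      (b := e)).exists_bound_of_continuousOn (hG a).continuousOn
    refine Integrable.of_bound (hG a).measurable.aestronglyMeasurable C ?_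
    filter_upwards [hbox] with θ hθ using hC θ fun i _ => hθ i
  have hLG : ∀ a, L a ≤ ∫ θ, G a θ ∂μ := by
    intro a
    have hmp : MeasurePreserving (fun p : (ι → ℝ) × ℝ => Function.update p.1 a p.2)
      (μ.prod (quarticPrior e)) μ := measurePreserving_update_pi (quarticPrior e) a
    -- Resampling coordinate a writes the mean over the box as a mean of line integrals, each of
    -- which is at least `L a`. A single prior thus serves all coordinates.
    have h1 : ∫ θ, G a θ ∂μ = ∫ θ, ∫ t, G a (Function.update θ a t) ∂quarticPrior e ∂μ := by
      have h2 := integral_map (μ := μ.prod (quarticPrior e)) (f := G a) hmp.measurable.aemeasurable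
        (hG a).measurable.aestronglyMeasurable
      rw [hmp.map_eq] at h2
      rw [h2, integral_prod]
      exact (hmp.integrable_comp (hG a).measurable.aestronglyMeasurable).2 (hint a)
    have h2 : ∫ _, L a ∂μ ≤ ∫ θ, ∫ t, G a (Function.update θ a t) ∂quarticPrior e ∂μ := by
      refine integral_mono_ae (integrable_const _) ?_ ?_
      · exact ((hmp.integrable_comp (hG a).measurable.aestronglyMeasurable).2
          (hint a)).integral_prod_left
      · filter_upwards [hbox] with θ hθ
        rw [integral_quarticPrior he]
        exact hL a θ hθ
    rw [h1]
    simpa using h2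
  calc ∑ a, w a * L a ≤ ∑ a, w a * ∫ θ, G a θ ∂μ :=
        Finset.sum_le_sum fun a _ => mul_le_mul_of_nonneg_left (hLG a) (hw a)
    _ = ∫ θ, ∑ a, w a * G a θ ∂μ := by
        rw [integral_finsetSum _ fun a _ => (hint a).const_mul _]
        exact Finset.sum_congr rfl fun a _ => (integral_const_mul _ _).symm
    _ ≤ ∫ _, B ∂μ := by
        refine integral_mono_ae (integrable_finsetSum _ fun a _ => (hint a).const_mul _)
          (integrable_const _) ?_
        filter_upwards [hbox] with θ hθ using hB θ hθ
    _ = B := by simp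

end ProductPrior

/-! ### Local minimax bound around a chain of independent samples -/

section LocalMinimax

variable {k m : ℕ}

/-- An affine perturbation of the transition weights all of whose rows are `b`. -/
def perturbedKernel (b : Fin k → ℝ) (H : Fin k × Fin k → Fin k → Fin k → ℝ)
    (θ : Fin k × Fin k → ℝ) (i j : Fin k) : ℝ :=
  b j + ∑ a, θ a * H a i j

/-- The information of one transition about the perturbation direction `H`, when all rows are
`b`. -/
def directionInfo (b : Fin k → ℝ) (H : Fin k → Fin k → ℝ) : ℝ :=
  ∑ i, b i * ∑ j, H i j ^ 2 / b j

theorem perturbedKernel_update (b : Fin k → ℝ) (H : Fin k × Fin k → Fin k → Fin k → ℝ)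
    (θ : Fin k × Fin k → ℝ) (a : Fin k × Fin k) (t : ℝ) (i j : Fin k) :
    perturbedKernel b H (Function.update θ a t) i j =
      perturbedKernel b H (Function.update θ a 0) i j + t * H a i j := by
  unfold perturbedKernel
  rw [add_assoc, ← Finset.add_sum_erase _ _ (Finset.mem_univ a),
    ← Finset.add_sum_erase Finset.univ (fun a' => Function.update θ a 0 a' * H a' i j)
      (Finset.mem_univ a)]
  simp only [Function.update_self, zero_mul, zero_add]
  rw [add_comm (t * _)]
  congr 2
  refine Finset.sum_congr rfl fun a' ha' => ?_
  rw [Function.update_of_ne (Finset.ne_of_mem_erase ha'),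
    Function.update_of_ne (Finset.ne_of_mem_erase ha')]

theorem sum_perturbedKernel {b : Fin k → ℝ} {H : Fin k × Fin k → Fin k → Fin k → ℝ}
    (hb : ∑ i, b i = 1) (hH : ∀ a i, ∑ j, H a i j = 0) (θ : Fin k × Fin k → ℝ) (i : Fin k) :
    ∑ j, perturbedKernel b H θ i j = 1 := by
  unfold perturbedKernel
  rw [Finset.sum_add_distrib, Finset.sum_comm, hb]
  simp [← Finset.mul_sum, hH]

theorem abs_perturbedKernel_sub_le {b : Fin k → ℝ} {H : Fin k × Fin k → Fin k → Fin k → ℝ}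
    (hH1 : ∀ a i j, |H a i j| ≤ 1) {r : ℝ} (hr : 0 ≤ r) {θ : Fin k × Fin k → ℝ}
    (hθ : ∀ a, |θ a| ≤ r / (k * k + 1)) (i j : Fin k) : |perturbedKernel b H θ i j - b j| ≤ r := by
  rw [perturbedKernel, add_sub_cancel_left]
  calc _ ≤ ∑ a, |θ a * H a i j| := Finset.abs_sum_le_sum_abs _ _
    _ ≤ ∑ _a : Fin k × Fin k, r / (k * k + 1) := Finset.sum_le_sum fun a _ => by
        rw [abs_mul]
        exact (mul_le_of_le_one_right (abs_nonneg _) (hH1 a i j)).trans (hθ a)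
    _ = k * k * (r / (k * k + 1)) := by simp
    _ ≤ r := by
        rw [mul_div_assoc', div_le_iff₀ (by positivity)]
        nlinarith

theorem sum_entry_le_of_forall_box {b : Fin k → ℝ} {H : Fin k × Fin k → Fin k → Fin k → ℝ}
    {β ζ e : ℝ} (hβ : 0 < β) (hb0 : ∀ i, β ≤ b i) (hb : ∑ i, b i = 1)
    (hH : ∀ a i, ∑ j, H a i j = 0) (hh : ∀ a, 0 ≤ H a a.1 a.2) (he : 0 < e) (hζ0 : 0 ≤ ζ)
    (hζ1 : ζ < 1)
    (hclose : ∀ θ : Fin k × Fin k → ℝ, (∀ a, θ a ∈ Icc (-e) e) →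
      ∀ i j, |perturbedKernel b H θ i j - b j| ≤ ζ * β)
    (T : (Fin (m + 1) → Fin k) → Fin k × Fin k → ℝ) {w : Fin k × Fin k → ℝ} (hw : ∀ a, 0 ≤ w a)
    {B : ℝ}
    (hB : ∀ θ : Fin k × Fin k → ℝ, (∀ a, θ a ∈ Icc (-e) e) →
      ∑ a, w a * pathMean b (perturbedKernel b H θ) m
        (fun x => (T x a - perturbedKernel b H θ a.1 a.2) ^ 2) ≤ B) :
    ∑ a, w a * (H a a.1 a.2 ^ 2 /
      (m * ((1 + ζ) / (1 - ζ) * directionInfo b (H a)) + 10 / e ^ 2)) ≤ B := by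
  have hb1 : ∀ i, 0 < b i := fun i => hβ.trans_le (hb0 i)
  have h1ζ : 0 < 1 - ζ := by linarith
  refine sum_le_of_forall_line he (G := fun a θ => pathMean b (perturbedKernel b H θ) m
    (fun x => (T x a - perturbedKernel b H θ a.1 a.2) ^ 2)) (fun a => ?_) hw (fun a θ hθ => ?_) hB
  · simp only [pathMean, pathWeight, perturbedKernel]
    fun_prop
  have hbox : ∀ t ∈ Icc (-e) e, ∀ a', Function.update θ a t a' ∈ Icc (-e) e := by
    intro t ht a'
    rcases eq_or_ne a' a with rfl | h
    · simpa using ht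
    · rw [Function.update_of_ne h]; exact hθ a'
  set A := perturbedKernel b H (Function.update θ a 0) with hA
  have hAt : ∀ t, perturbedKernel b H (Function.update θ a t) =
      fun i j => A i j + t * H a i j := fun t => by
    funext i j
    exact perturbedKernel_update b H θ a t i j
  have hlow : ∀ t ∈ Icc (-e) e, ∀ i j, (1 - ζ) * b j ≤ A i j + t * H a i j := by
    intro t ht i j
    have h1 := hclose _ (hbox t ht) i j
    rw [hAt] at h1
    have h2 : ζ * β ≤ ζ * b j := mul_le_mul_of_nonneg_left (hb0 j) hζ0
    linarith [(abs_le.1 h1).1]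
  have hup : ∀ t ∈ Icc (-e) e, ∀ i j, A i j + t * H a i j ≤ (1 + ζ) * b j := by
    intro t ht i j
    have h1 := hclose _ (hbox t ht) i j
    rw [hAt] at h1
    have h2 : ζ * β ≤ ζ * b j := mul_le_mul_of_nonneg_left (hb0 j) hζ0
    linarith [(abs_le.1 h1).2]
  have hpos : ∀ t ∈ Icc (-e) e, ∀ i j, 0 < A i j + t * H a i j := fun t ht i j =>
    (mul_pos h1ζ (hb1 j)).trans_le (hlow t ht i j)
  have hψ : ∀ t ∈ Icc (-e) e, ∀ i, ∑ j, H a i j ^ 2 / (A i j + t * H a i j) ≤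
      (1 - ζ)⁻¹ * ∑ j, H a i j ^ 2 / b j := by
    intro t ht i
    rw [Finset.mul_sum]
    refine Finset.sum_le_sum fun j _ => ?_
    calc _ ≤ H a i j ^ 2 / ((1 - ζ) * b j) :=
          div_le_div_of_nonneg_left (sq_nonneg _) (mul_pos h1ζ (hb1 j)) (hlow t ht i j)
      _ = _ := by field_simp
  have hψ0 : ∀ i, 0 ≤ ∑ j, H a i j ^ 2 / b j := fun i =>
    Finset.sum_nonneg fun j _ => div_nonneg (sq_nonneg _) (hb1 j).le
  -- Used with v the initial law b and with v any row of the perturbed matrix: these are the laws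
  -- needed for the information bound, and the weights b and 1/b inside it each cost one factor near
  -- 1.
  have hgen : ∀ t ∈ Icc (-e) e, ∀ v : Fin k → ℝ, (∀ i, 0 ≤ v i) → (∀ i, v i ≤ (1 + ζ) * b i) →
      ∑ i, v i * ∑ j, H a i j ^ 2 / (A i j + t * H a i j) ≤
        (1 + ζ) / (1 - ζ) * directionInfo b (H a) := by
    intro t ht v hv0 hv
    rw [directionInfo, Finset.mul_sum]
    refine Finset.sum_le_sum fun i _ => ?_
    calc _ ≤ v i * ((1 - ζ)⁻¹ * ∑ j, H a i j ^ 2 / b j) :=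
          mul_le_mul_of_nonneg_left (hψ t ht i) (hv0 i)
      _ ≤ (1 + ζ) * b i * ((1 - ζ)⁻¹ * ∑ j, H a i j ^ 2 / b j) :=
          mul_le_mul_of_nonneg_right (hv i) (mul_nonneg (inv_nonneg.2 h1ζ.le) (hψ0 i))
      _ = _ := by ring
  have hI : 0 ≤ (1 + ζ) / (1 - ζ) * directionInfo b (H a) :=
    mul_nonneg (div_nonneg (by linarith) h1ζ.le)
      (Finset.sum_nonneg fun i _ => mul_nonneg (hb1 i).le (hψ0 i))
  have := van_trees (m := m) (A := A) (c := A a.1 a.2) he (hh a) (fun i => (hb1 i).le) hb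
    (sum_perturbedKernel hb hH _) (hH a) hpos hI
    (fun t ht => hgen t ht b (fun i => (hb1 i).le) fun i => by nlinarith [hb1 i])
    (fun t ht i => hgen t ht _ (fun l => (hpos t ht i l).le) (hup t ht i)) (fun x => T x a)
  clear_value A
  simpa only [hAt] using this

variable {f : ℝ → ℝ}

/-- Stationarity makes π_j a π-average of the entries of column j. -/
theorem MarkovModel.abs_stat_sub_le {P : MarkovModel k} {b : Fin k → ℝ} {r : ℝ}
    (h : ∀ i j, |P.prob i j - b j| ≤ r) (j : Fin k) : |P.stat j - b j| ≤ r := by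
  have h1 : P.stat j - b j = ∑ i, P.stat i * (P.prob i j - b j) := by
    simp only [mul_sub, Finset.sum_sub_distrib, P.sum_stat_mul_prob, ← Finset.sum_mul,
      P.stat_mem.2, one_mul]
  rw [h1]
  calc _ ≤ ∑ i, |P.stat i * (P.prob i j - b j)| := Finset.abs_sum_le_sum_abs _ _
    _ ≤ ∑ i, P.stat i * r := Finset.sum_le_sum fun i _ => by
        rw [abs_mul, abs_of_nonneg (P.stat_mem.1 i)]
        exact mul_le_mul_of_nonneg_left (h i j) (P.stat_mem.1 i)
    _ = r := by rw [← Finset.sum_mul, P.stat_mem.2, one_mul]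

/-- A class of chains contains all small perturbations, in the directions `H`, of the chain with
independent samples from `b`. -/
structure IsPerturbationFamily (S : Set (MarkovModel k)) (b : Fin k → ℝ)
    (H : Fin k × Fin k → Fin k → Fin k → ℝ) : Prop where
  pos : ∃ β : ℝ, 0 < β ∧ ∀ i, β ≤ b i
  sum_eq_one : ∑ i, b i = 1
  sum_row : ∀ a i, ∑ j, H a i j = 0
  abs_le_one : ∀ a i j, |H a i j| ≤ 1
  entry_nonneg : ∀ a, 0 ≤ H a a.1 a.2
  exists_mem : ∃ e : ℝ, 0 < e ∧ ∀ θ : Fin k × Fin k → ℝ, (∀ a, |θ a| ≤ e) →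
    ∃ P ∈ S, P.init = b ∧ P.prob = perturbedKernel b H θ

/-- The sum over a row of the local lower bounds for the relative squared errors of its entries. -/
def rowBound (b : Fin k → ℝ) (H : Fin k × Fin k → Fin k → Fin k → ℝ) (i : Fin k) : ℝ :=
  ∑ j, H (i, j) i j ^ 2 / (b j * directionInfo b (H (i, j)))

/-- A local asymptotic minimax bound. -/
theorem IsOrdinary.eventually_local_minimax (hf : IsOrdinary f) {S : Set (MarkovModel k)}
    {b : Fin k → ℝ} {H : Fin k × Fin k → Fin k → Fin k → ℝ} (hS : IsPerturbationFamily S b H)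
    {η : ℝ} (hη0 : 0 < η) (hη1 : η < 1) :
    ∀ᶠ n : ℕ in atTop, ∀ E : Estimator n k, ∀ w : Fin k → ℝ, (∀ i, 0 ≤ w i) → ∀ B : ℝ,
      (∀ P ∈ S, (∀ j, |P.stat j - b j| ≤ η * b j) →
        ∑ i, (w i : EReal) * stateRisk (fDiv f) P E i ≤ B) →
      (1 - η) * (iteratedDeriv 2 f 1 / 2) / n * ∑ i, w i * rowBound b H i ≤ B := by
  unfold rowBound
  obtain ⟨⟨β, hβ, hb0⟩, hb, hH, hH1, hh, e₀, he₀, hfam⟩ := hS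
  have ha : 0 < iteratedDeriv 2 f 1 / 2 := half_pos hf.deriv_two_pos
  have hb1 : ∀ i, 0 < b i := fun i => hβ.trans_le (hb0 i)
  -- One factor 1 − ζ is lost in the truncation, (1 + ζ)/(1 − ζ) in the information, and a further ζ
  -- in the prior information; together these cost at most 1 − η.
  set ζ := η / 4 with hζ
  have hζ0 : 0 < ζ := by positivity
  have hζ1 : ζ < 1 := by linarith
  have h1ζ : 0 < 1 - ζ := by linarith
  obtain ⟨ε, hε, T, hT⟩ := hf.exists_truncation hβ hb0 hζ0 hζ1
  set a₀ := iteratedDeriv 2 f 1 / 2 with ha₀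
  set r := min (ζ * β) ε with hr
  have hr0 : 0 < r := by positivity
  set e := min e₀ (r / (k * k + 1)) with he
  have he0 : 0 < e := by positivity
  have hclose : ∀ θ : Fin k × Fin k → ℝ, (∀ a, θ a ∈ Icc (-e) e) →
      ∀ i j, |perturbedKernel b H θ i j - b j| ≤ r := fun θ hθ =>
    abs_perturbedKernel_sub_le hH1 hr0.le fun a => (abs_le.2 (hθ a)).trans (min_le_right _ _)
  have hasym : ∀ᶠ n : ℕ in atTop, ∀ a : Fin k × Fin k,
      (1 - η) / (1 - ζ) / n * (H a a.1 a.2 ^ 2 / directionInfo b (H a)) ≤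
      H a a.1 a.2 ^ 2 / (n * ((1 + ζ) / (1 - ζ) * directionInfo b (H a)) + 10 / e ^ 2) := by
    rw [eventually_all]
    intro a
    rcases (hh a).eq_or_lt with h0 | h0
    · rw [← h0]
      exact Eventually.of_forall fun n => by simp
    have hI : 0 < directionInfo b (H a) := by
      refine Finset.sum_pos' (fun i _ => mul_nonneg (hb1 i).le (Finset.sum_nonneg fun j _ =>
        div_nonneg (sq_nonneg _) (hb1 j).le)) ⟨a.1, Finset.mem_univ _, mul_pos (hb1 _) ?_⟩
      refine Finset.sum_pos' (fun j _ => div_nonneg (sq_nonneg _) (hb1 j).le)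
        ⟨a.2, Finset.mem_univ _, ?_⟩
      have := hb1 a.2
      positivity
    set I := directionInfo b (H a)
    -- From this sample size on, the prior information is at most the fraction ζ of the sample
    -- information.
    obtain ⟨N, hN⟩ := exists_nat_ge (10 / e ^ 2 / (ζ * I))
    filter_upwards [eventually_ge_atTop (max N 1)] with n hn
    have hn1 : (1 : ℝ) ≤ n := by exact_mod_cast (le_max_right _ _).trans hn
    have hn0 : (0 : ℝ) < n := by linarith
    have h2 : 10 / e ^ 2 ≤ n * (ζ * I) := by
      rw [← div_le_iff₀ (by positivity)]
      exact hN.trans (by exact_mod_cast (le_max_left _ _).trans hn)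
    have h3 : (1 - η) / (1 - ζ) * ((1 + ζ) / (1 - ζ) + ζ) ≤ 1 := by
      have h4 : (1 - η) / (1 - ζ) * ((1 + ζ) / (1 - ζ) + ζ) =
          (1 - η) * (1 + ζ + ζ * (1 - ζ)) / (1 - ζ) ^ 2 := by field_simp
      rw [h4, div_le_one (by positivity), show η = 4 * ζ by rw [hζ]; ring]
      nlinarith [mul_pos hζ0 hζ0, mul_pos (mul_pos hζ0 hζ0) h1ζ]
    calc (1 - η) / (1 - ζ) / n * (H a a.1 a.2 ^ 2 / I)
        = (1 - η) / (1 - ζ) * (H a a.1 a.2 ^ 2 / (n * I)) := by field_simp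
      _ ≤ H a a.1 a.2 ^ 2 / (n * ((1 + ζ) / (1 - ζ) * I) + 10 / e ^ 2) := by
          rw [mul_div_assoc', div_le_div_iff₀ (by positivity) (by positivity)]
          have h5 : (1 - η) / (1 - ζ) * (n * ((1 + ζ) / (1 - ζ) * I) + 10 / e ^ 2) ≤ n * I := by
            calc _ ≤ (1 - η) / (1 - ζ) * (n * ((1 + ζ) / (1 - ζ) * I) + n * (ζ * I)) :=
                  mul_le_mul_of_nonneg_left (by linarith)
                    (div_nonneg (by linarith) h1ζ.le)
              _ = (1 - η) / (1 - ζ) * ((1 + ζ) / (1 - ζ) + ζ) * (n * I) := by ring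
              _ ≤ 1 * (n * I) := mul_le_mul_of_nonneg_right h3 (by positivity)
              _ = _ := one_mul _
          nlinarith [mul_le_mul_of_nonneg_left h5 (sq_nonneg (H a a.1 a.2))]
  filter_upwards [hasym, eventually_ge_atTop 1] with n hn hn1 E w hw B hB
  obtain ⟨m, rfl⟩ : ∃ m, n = m + 1 := ⟨n - 1, by omega⟩
  have hmn : (m : ℝ) ≤ (m + 1 : ℕ) := by push_cast; linarith
  have hn0 : (0 : ℝ) < (m + 1 : ℕ) := by positivity
  -- With these weights the sum of squared entry errors is the truncated quadratic loss, weighted by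
  -- `w` over the rows.
  set w' : Fin k × Fin k → ℝ := fun a => (1 - ζ) * a₀ * (w a.1 * (1 / b a.2)) with hw'
  have hw'0 : ∀ a, 0 ≤ w' a := fun a =>
    mul_nonneg (mul_pos h1ζ ha).le (mul_nonneg (hw _) (div_pos one_pos (hb1 _)).le)
  have hmain := sum_entry_le_of_forall_box (m := m) hβ hb0 hb hH hh he0 hζ0.le hζ1
    (fun θ hθ i j => (hclose θ hθ i j).trans (min_le_left _ _))
    (fun x a => T ((E x).1 a.1) a.2) hw'0 (B := B) fun θ hθ => by
      obtain ⟨P, hPS, hPi, hPp⟩ := hfam θ fun a => (abs_le.2 (hθ a)).trans (min_le_left _ _)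
      have hPr : ∀ i j, |P.prob i j - b j| ≤ r := by rw [hPp]; exact hclose θ hθ
      have h1 := hB P hPS fun j => (P.abs_stat_sub_le hPr j).trans <| (min_le_left _ _).trans <|
        mul_le_mul (by linarith) (hb0 j) hβ.le hη0.le
      have h2 : ∀ i, ((pathMean P.init P.prob m fun x => (1 - ζ) * a₀ *
          ∑ j, (P.prob i j - T ((E x).1 i) j) ^ 2 / b j : ℝ) : EReal) ≤
          stateRisk (fDiv f) P E i := fun i => pathMean_le_stateRisk fun x =>
        hT _ _ (P.sum_prob i) ((Matrix.mem_rowStochastic_iff_sum.1 (E x).2).2 i)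
          (fun j => by
            have h3 := (abs_le.1 ((hPr i j).trans (min_le_left _ _))).1
            have h4 : ζ * β < 1 * β := mul_lt_mul_of_pos_right hζ1 hβ
            linarith [hb0 j])
          (fun j => (E x).2.1 i j) fun j => (hPr i j).trans (min_le_right _ _)
      have h3 : ((∑ i, w i * pathMean P.init P.prob m fun x => (1 - ζ) * a₀ *
          ∑ j, (P.prob i j - T ((E x).1 i) j) ^ 2 / b j : ℝ) : EReal) ≤ B := by
        refine le_trans ?_ h1
        rw [EReal.coe_sum_finset]
        refine Finset.sum_le_sum fun i _ => ?_
        rw [EReal.coe_mul]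
        exact mul_le_mul_of_nonneg_left (h2 i) (by exact_mod_cast hw i)
      rw [EReal.coe_le_coe_iff, hPi, hPp] at h3
      refine le_trans (le_of_eq ?_) h3
      rw [Fintype.sum_prod_type]
      refine Finset.sum_congr rfl fun i _ => ?_
      rw [pathMean_const_mul, pathMean_sum, Finset.mul_sum, Finset.mul_sum]
      refine Finset.sum_congr rfl fun j _ => ?_
      have h4 : (fun x : Fin (m + 1) → Fin k =>
          (perturbedKernel b H θ i j - T ((E x).1 i) j) ^ 2 / b j) = fun x =>
          1 / b j * (T ((E x).1 i) j - perturbedKernel b H θ i j) ^ 2 := by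
        funext x
        ring
      rw [h4, pathMean_const_mul]
      simp only [hw']
      ring
  refine le_trans ?_ hmain
  rw [Fintype.sum_prod_type, Finset.mul_sum]
  refine Finset.sum_le_sum fun i _ => ?_
  rw [Finset.mul_sum, Finset.mul_sum]
  refine Finset.sum_le_sum fun j _ => ?_
  have h1 := hn (i, j)
  have h2 : H (i, j) i j ^ 2 / ((m + 1 : ℕ) * ((1 + ζ) / (1 - ζ) * directionInfo b (H (i, j))) +
      10 / e ^ 2) ≤ H (i, j) i j ^ 2 / (m * ((1 + ζ) / (1 - ζ) * directionInfo b (H (i, j))) +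
      10 / e ^ 2) := by
    have hI : 0 ≤ directionInfo b (H (i, j)) :=
      Finset.sum_nonneg fun i _ => mul_nonneg (hb1 i).le
        (Finset.sum_nonneg fun j _ => div_nonneg (sq_nonneg _) (hb1 j).le)
    have : 0 ≤ (1 + ζ) / (1 - ζ) * directionInfo b (H (i, j)) :=
      mul_nonneg (div_nonneg (by linarith) h1ζ.le) hI
    gcongr
  refine le_trans (le_of_eq ?_) (mul_le_mul_of_nonneg_left (h1.trans h2) (hw'0 (i, j)))
  have := (hb1 j).ne'
  simp only [hw']
  rw [div_mul_eq_div_div]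
  field_simp

end LocalMinimax

/-! ### From the local bound to the minimax risks -/

section LowerBound

variable {k n : ℕ} {f : ℝ → ℝ} {δ ρ : ℝ}

/-- M − 1 kills the constant vector, so it also has a left null vector v. Entrywise |v| ≤ |v| M with
equal total sums, so equality holds and |v| can be normalised. -/
theorem exists_stationary (hk : 0 < k) {M : Matrix (Fin k) (Fin k) ℝ}
    (hM : M ∈ Matrix.rowStochastic ℝ (Fin k)) :
    ∃ π ∈ stdSimplex ℝ (Fin k), Matrix.vecMul π M = π := by
  obtain ⟨hM0, hM1⟩ := Matrix.mem_rowStochastic_iff_sum.1 hM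
  have hdet : (M - 1).det = 0 := by
    refine Matrix.exists_mulVec_eq_zero_iff.1 ⟨1, ?_, ?_⟩
    · intro h
      have := congrFun h ⟨0, hk⟩
      simp at this
    · rw [Matrix.sub_mulVec, Matrix.one_mulVec, Matrix.one_vecMul_of_mem_rowStochastic hM, sub_self]
  obtain ⟨v, hv0, hv⟩ := Matrix.exists_vecMul_eq_zero_iff.2 hdet
  rw [Matrix.vecMul_sub, Matrix.vecMul_one, sub_eq_zero] at hv
  have hv' : ∀ j, ∑ i, v i * M i j = v j := fun j => congrFun hv j
  have hle : ∀ j ∈ Finset.univ, |v j| ≤ ∑ i, |v i| * M i j := fun j _ => by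
    rw [← hv' j]
    refine (Finset.abs_sum_le_sum_abs _ _).trans (Finset.sum_le_sum fun i _ => ?_)
    rw [abs_mul, abs_of_nonneg (hM0 i j)]
  have hsum : ∑ j, |v j| = ∑ j, ∑ i, |v i| * M i j := by
    rw [Finset.sum_comm]
    simp only [← Finset.mul_sum, hM1, mul_one]
  have heq := (Finset.sum_eq_sum_iff_of_le hle).1 hsum
  have hpos : 0 < ∑ j, |v j| := by
    obtain ⟨i, hi⟩ := Function.ne_iff.1 hv0
    exact Finset.sum_pos' (fun _ _ => abs_nonneg _) ⟨i, Finset.mem_univ _, abs_pos.2 hi⟩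
  refine ⟨fun j => |v j| / ∑ i, |v i|, ⟨fun j => by positivity, ?_⟩, ?_⟩
  · rw [← Finset.sum_div, div_self hpos.ne']
  · funext j
    change ∑ i, |v i| / (∑ l, |v l|) * M i j = |v j| / ∑ l, |v l|
    rw [heq j (Finset.mem_univ j), Finset.sum_div]
    exact Finset.sum_congr rfl fun i _ => by ring

theorem IsOrdinary.stateRisk_nonneg (hf : IsOrdinary f) {P : MarkovModel k}
    (hP : ∀ i j, 0 < P.trans i j) (E : Estimator n k) (i : Fin k) :
    0 ≤ stateRisk (fDiv f) P E i := by
  cases n with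
  | zero =>
    refine Finset.sum_nonneg fun x _ => mul_nonneg (by simp [MarkovModel.pathProb]) ?_
    exact hf.fDiv_nonneg ((P.sum_prob i).trans
      ((Matrix.mem_rowStochastic_iff_sum.1 (E x).2).2 i).symm) (hP i) ((E x).2.1 i)
  | succ m =>
    have := pathMean_le_stateRisk (P := P) (L := fDiv f) (E := E) (i := i) (B := fun _ => 0)
      fun x => hf.fDiv_nonneg ((P.sum_prob i).trans
        ((Matrix.mem_rowStochastic_iff_sum.1 (E x).2).2 i).symm) (hP i) ((E x).2.1 i)
    simpa [pathMean] using this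

theorem IsOrdinary.weightedRisk_nonneg (hf : IsOrdinary f) (hδ : 0 < δ) {P : MarkovModel k}
    (hP : P ∈ chainClass k δ ρ) (E : Estimator n k) : 0 ≤ weightedRisk (fDiv f) P E :=
  Finset.sum_nonneg fun i _ => mul_nonneg (by exact_mod_cast P.stat_mem.1 i)
    (hf.stateRisk_nonneg (fun i j => hδ.trans_le (hP.1 i j)) E i)

theorem IsOrdinary.worstRisk_nonneg (hf : IsOrdinary f) (hk : 0 < k) (hδ : 0 < δ)
    {P : MarkovModel k} (hP : P ∈ chainClass k δ ρ) (E : Estimator n k) :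
    0 ≤ worstRisk (fDiv f) P E :=
  le_iSup_of_le ⟨0, hk⟩ (hf.stateRisk_nonneg (fun i j => hδ.trans_le (hP.1 i j)) E _)

theorem IsOrdinary.minimaxWeighted_nonneg (hf : IsOrdinary f) (hδ : 0 < δ)
    (hne : (chainClass k δ ρ).Nonempty) : 0 ≤ minimaxWeighted (fDiv f) (chainClass k δ ρ) n := by
  obtain ⟨P, hP⟩ := hne
  exact le_iInf fun E => le_iSup₂_of_le P hP (hf.weightedRisk_nonneg hδ hP E)

theorem IsOrdinary.minimaxWorst_nonneg (hf : IsOrdinary f) (hk : 0 < k) (hδ : 0 < δ)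
    (hne : (chainClass k δ ρ).Nonempty) : 0 ≤ minimaxWorst (fDiv f) (chainClass k δ ρ) n := by
  obtain ⟨P, hP⟩ := hne
  exact le_iInf fun E => le_iSup₂_of_le P hP (hf.worstRisk_nonneg hk hδ hP E)

/-- Lets the local bound, stated for real B, be applied to an extended supremum; an infinite one is
trivial. -/
theorem EReal.coe_le_of_forall_coe {x : ℝ} {V : EReal} (hV : 0 ≤ V)
    (h : ∀ B : ℝ, V ≤ B → x ≤ B) : (x : EReal) ≤ V := by
  induction V using EReal.rec with
  | bot => exact absurd hV (by simp)
  | coe B => exact_mod_cast h B le_rfl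
  | top => exact le_top

theorem IsOrdinary.eventually_le_minimaxWeighted (hf : IsOrdinary f) (hδ : 0 < δ)
    (hne : (chainClass k δ ρ).Nonempty) {b : Fin k → ℝ}
    {H : Fin k × Fin k → Fin k → Fin k → ℝ}
    (hS : IsPerturbationFamily (chainClass k δ ρ) b H) {η : ℝ} (hη0 : 0 < η) (hη1 : η < 1) :
    ∀ᶠ n : ℕ in atTop, (((1 - η) ^ 2 * (iteratedDeriv 2 f 1 / 2) / n *
      ∑ i, b i * rowBound b H i : ℝ) : EReal) ≤
        minimaxWeighted (fDiv f) (chainClass k δ ρ) n := by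
  filter_upwards [hf.eventually_local_minimax hS hη0 hη1] with n hn
  obtain ⟨P₀, hP₀⟩ := hne
  obtain ⟨β, hβ, hb⟩ := hS.pos
  have hb0 : ∀ i, 0 ≤ b i := fun i => hβ.le.trans (hb i)
  refine le_iInf fun E => EReal.coe_le_of_forall_coe
    (le_iSup₂_of_le P₀ hP₀ (hf.weightedRisk_nonneg hδ hP₀ E)) fun B hB => ?_
  -- The local bound needs weights that do not depend on the chain: in the family π_i ≥ (1 − η) b_i
  -- and the state risks are nonnegative. This produces the second factor 1 − η.
  have := hn E (fun i => (1 - η) * b i) (fun i => mul_nonneg (by linarith) (hb0 i)) B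
    fun P hP hPb => by
      refine le_trans (Finset.sum_le_sum fun i _ => ?_)
        ((le_iSup₂ (f := fun P (_ : P ∈ chainClass k δ ρ) => weightedRisk (fDiv f) P E)
          P hP).trans hB)
      refine mul_le_mul_of_nonneg_right ?_
        (hf.stateRisk_nonneg (fun i j => hδ.trans_le (hP.1 i j)) E i)
      rw [EReal.coe_le_coe_iff]
      linarith [(abs_le.1 (hPb i)).1]
  refine le_trans (le_of_eq ?_) this
  simp only [mul_assoc, ← Finset.mul_sum]
  ring

theorem IsOrdinary.eventually_le_minimaxWorst (hf : IsOrdinary f) (hδ : 0 < δ)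
    (hne : (chainClass k δ ρ).Nonempty) {b : Fin k → ℝ}
    {H : Fin k × Fin k → Fin k → Fin k → ℝ}
    (hS : IsPerturbationFamily (chainClass k δ ρ) b H) {η : ℝ} (hη0 : 0 < η) (hη1 : η < 1)
    (i : Fin k) :
    ∀ᶠ n : ℕ in atTop, (((1 - η) * (iteratedDeriv 2 f 1 / 2) / n * rowBound b H i : ℝ) : EReal) ≤
      minimaxWorst (fDiv f) (chainClass k δ ρ) n := by
  filter_upwards [hf.eventually_local_minimax hS hη0 hη1] with n hn
  obtain ⟨P₀, hP₀⟩ := hne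
  refine le_iInf fun E => EReal.coe_le_of_forall_coe
    (le_iSup₂_of_le P₀ hP₀ (hf.worstRisk_nonneg i.pos hδ hP₀ E)) fun B hB => ?_
  have := hn E (Pi.single i 1) (fun j => by
      rcases eq_or_ne j i with rfl | h
      · simp
      · simp [h]) B
    fun P hP _ => by
      refine le_trans (le_of_eq ?_) ((le_iSup (fun i => stateRisk (fDiv f) P E i) i).trans
        ((le_iSup₂ (f := fun P (_ : P ∈ chainClass k δ ρ) => worstRisk (fDiv f) P E)
          P hP).trans hB))
      rw [Finset.sum_eq_single i]
      · simp
      · intro j _ hj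
        simp [hj]
      · simp
  refine le_trans (le_of_eq ?_) this
  rw [Finset.sum_eq_single i]
  · simp
  · intro j _ hj
    simp [hj]
  · simp

end LowerBound

/-! ### The two perturbation families -/

section Families

variable {k : ℕ} {δ ρ : ℝ}

/-- The chain with given initial distribution, transition probabilities and stationary
distribution. -/
def MarkovModel.ofProb (b π : Fin k → ℝ) (M : Fin k → Fin k → ℝ) (hb : b ∈ stdSimplex ℝ (Fin k))
    (hM : Matrix.of M ∈ Matrix.rowStochastic ℝ (Fin k)) (hπ : π ∈ stdSimplex ℝ (Fin k))
    (hπM : Matrix.vecMul π (Matrix.of M) = π) : MarkovModel k :=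
  ⟨b, Matrix.of M, π, hb, hM, hπ, hπM⟩

/-- The unit vector at `j` minus the uniform distribution on a set of size `N`. -/
def centeredUnit (N : ℝ) (j l : Fin k) : ℝ := (if l = j then 1 else 0) - 1 / N

theorem sum_centeredUnit (hk : 0 < k) (j : Fin k) : ∑ l, centeredUnit k j l = 0 := by
  have : (k : ℝ) ≠ 0 := by positivity
  simp [centeredUnit, Finset.sum_sub_distrib, this]

theorem abs_centeredUnit_le {N : ℝ} (hN : 1 ≤ N) (j l : Fin k) : |centeredUnit N j l| ≤ 1 := by
  have h1 : 0 < 1 / N := by positivity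
  have h2 : 1 / N ≤ 1 := by rw [div_le_one (by linarith)]; exact hN
  unfold centeredUnit
  split_ifs <;> rw [abs_le] <;> constructor <;> linarith

theorem sum_centeredUnit_sq {N : ℝ} (j : Fin k) :
    ∑ l, centeredUnit N j l ^ 2 = 1 - 2 / N + k * (1 / N) ^ 2 := by
  have : ∀ l, centeredUnit N j l ^ 2 =
      (if l = j then 1 - 2 / N else 0) + (1 / N) ^ 2 := by
    intro l
    unfold centeredUnit
    split_ifs <;> ring
  simp [this, Finset.sum_add_distrib]

/-- Directions that keep the uniform distribution stationary. -/
def uniformDirection (a : Fin k × Fin k) (i j : Fin k) : ℝ :=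
  centeredUnit k a.1 i * centeredUnit k a.2 j

/-- The directions have zero row and column sums, so the perturbed matrices stay doubly stochastic
and the smallest stationary probability is exactly 1/k. -/
theorem isPerturbationFamily_uniform (hk : 0 < k) (hδ : 0 < δ) (hδk : δ < 1 / (k : ℝ)) :
    IsPerturbationFamily (chainClass k δ (1 / k)) (fun _ => 1 / k) uniformDirection := by
  have hk0 : (0 : ℝ) < k := by positivity
  have hk1 : (1 : ℝ) ≤ k := by exact_mod_cast hk
  have hb1 : ∑ _i : Fin k, 1 / (k : ℝ) = 1 := by simp [hk0.ne']
  have hrow : ∀ (a : Fin k × Fin k) i, ∑ j, uniformDirection a i j = 0 := fun a i => by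
    simp only [uniformDirection, ← Finset.mul_sum, sum_centeredUnit hk, mul_zero]
  have hle : ∀ (a : Fin k × Fin k) i j, |uniformDirection a i j| ≤ 1 := fun a i j => by
    rw [uniformDirection, abs_mul]
    exact mul_le_one₀ (abs_centeredUnit_le hk1 _ _) (abs_nonneg _) (abs_centeredUnit_le hk1 _ _)
  refine ⟨⟨1 / k, by positivity, fun _ => le_rfl⟩, hb1, hrow, hle, fun a => ?_,
    (1 / k - δ) / (k * k + 1), div_pos (by linarith) (by positivity), fun θ hθ => ?_⟩
  · have : uniformDirection a a.1 a.2 = (1 - 1 / (k : ℝ)) * (1 - 1 / (k : ℝ)) := by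
      simp [uniformDirection, centeredUnit]
    rw [this]
    exact mul_self_nonneg _
  have hclose := abs_perturbedKernel_sub_le (b := fun _ => 1 / (k : ℝ)) hle
    (by linarith : 0 ≤ 1 / (k : ℝ) - δ) hθ
  have hδM : ∀ i j, δ ≤ perturbedKernel (fun _ => 1 / (k : ℝ)) uniformDirection θ i j :=
    fun i j => by linarith [(abs_le.1 (hclose i j)).1]
  have hb : (fun _ : Fin k => 1 / (k : ℝ)) ∈ stdSimplex ℝ (Fin k) :=
    ⟨fun _ => by positivity, hb1⟩
  refine ⟨MarkovModel.ofProb _ (fun _ => 1 / (k : ℝ)) _ hb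
    (Matrix.mem_rowStochastic_iff_sum.2 ⟨fun i j => hδ.le.trans (hδM i j),
      sum_perturbedKernel hb1 hrow θ⟩) hb ?_, ⟨hδM, ?_⟩, rfl, rfl⟩
  · funext j
    change ∑ i, 1 / (k : ℝ) * perturbedKernel (fun _ => 1 / (k : ℝ)) uniformDirection θ i j = 1 / k
    rw [← Finset.mul_sum]
    have h1 : ∑ i, perturbedKernel (fun _ => 1 / (k : ℝ)) uniformDirection θ i j = 1 := by
      unfold perturbedKernel
      rw [Finset.sum_add_distrib, hb1, Finset.sum_comm]
      simp [uniformDirection, ← Finset.mul_sum, ← Finset.sum_mul, sum_centeredUnit hk]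
    rw [h1, mul_one]
  · exact ⟨⟨⟨0, hk⟩, rfl⟩, by rintro _ ⟨i, rfl⟩; exact le_rfl⟩

/-- The product of centred units is the projection of the unit matrix at an entry onto the matrices
with zero row and column sums, hence the hardest admissible direction for that entry. Both its value
there and its information equal (1 − 1/k)². -/
theorem rowBound_uniform (hk : 2 ≤ k) (i : Fin k) :
    rowBound (fun _ => 1 / (k : ℝ)) uniformDirection i = ((k : ℝ) - 1) ^ 2 := by
  have hk2 : (2 : ℝ) ≤ k := by exact_mod_cast hk
  have hk0 : (k : ℝ) ≠ 0 := by positivity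
  have hk1 : (k : ℝ) - 1 ≠ 0 := by linarith
  have hI : ∀ a : Fin k × Fin k, directionInfo (fun _ => 1 / (k : ℝ)) (uniformDirection a) =
      (1 - 1 / k) ^ 2 := by
    intro a
    simp only [directionInfo, uniformDirection, mul_pow]
    simp only [← Finset.sum_div, ← Finset.mul_sum, sum_centeredUnit_sq, ← Finset.sum_mul]
    field_simp
    ring
  unfold rowBound
  simp only [hI]
  simp only [uniformDirection, centeredUnit, if_true]
  simp only [Finset.sum_const, Finset.card_univ, Fintype.card_fin, nsmul_eq_mul]
  field_simp

/-- A distribution with mass `ρ` at `z` that is uniform on the other states. -/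
def pointedDist (ρ : ℝ) (z : Fin k) (j : Fin k) : ℝ := if j = z then ρ else (1 - ρ) / (k - 1)

/-- Directions that change one row, away from the column `z`. -/
def pointedDirection (z : Fin k) (a : Fin k × Fin k) (i j : Fin k) : ℝ :=
  if i = a.1 ∧ a.2 ≠ z ∧ j ≠ z then centeredUnit (k - 1) a.2 j else 0

theorem sum_pointedDist (hk : 2 ≤ k) (z : Fin k) : ∑ j, pointedDist ρ z j = 1 := by
  have hk2 : (2 : ℝ) ≤ k := by exact_mod_cast hk
  have hk1 : (k : ℝ) - 1 ≠ 0 := by linarith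
  have : ∀ j, pointedDist ρ z j = (1 - ρ) / (k - 1) +
      if j = z then ρ - (1 - ρ) / (k - 1) else 0 := by
    intro j
    unfold pointedDist
    split_ifs <;> ring
  simp only [this, Finset.sum_add_distrib, Finset.sum_ite_eq', Finset.mem_univ, if_true,
    Finset.sum_const, Finset.card_univ, Fintype.card_fin, nsmul_eq_mul]
  field_simp
  ring

theorem sum_ne_centeredUnit (hk : 2 ≤ k) {z j : Fin k} (hj : j ≠ z) :
    ∑ l, (if l ≠ z then centeredUnit ((k : ℝ) - 1) j l else 0) = 0 := by
  have hk2 : (2 : ℝ) ≤ k := by exact_mod_cast hk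
  have hk1 : (k : ℝ) - 1 ≠ 0 := by linarith
  have : ∀ l, (if l ≠ z then centeredUnit ((k : ℝ) - 1) j l else 0) =
      (if l = j then 1 else 0) - 1 / ((k : ℝ) - 1) + if l = z then 1 / ((k : ℝ) - 1) else 0 := by
    intro l
    unfold centeredUnit
    rcases eq_or_ne l z with rfl | h
    · simp [hj.symm]
    · simp [h]
  simp only [this, Finset.sum_add_distrib, Finset.sum_sub_distrib, Finset.sum_ite_eq',
    Finset.mem_univ, if_true, Finset.sum_const, Finset.card_univ, Fintype.card_fin, nsmul_eq_mul]
  field_simp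
  ring

/-- Column z stays constantly ρ, which forces π_z = ρ; all other entries remain at least ρ, so the
other stationary probabilities do too. -/
theorem isPerturbationFamily_pointed (hk : 2 ≤ k) (hδ : 0 < δ) (hδρ : δ ≤ ρ)
    (hρk : ρ < 1 / (k : ℝ)) (z : Fin k) :
    IsPerturbationFamily (chainClass k δ ρ) (pointedDist ρ z) (pointedDirection z) := by
  have hk2 : (2 : ℝ) ≤ k := by exact_mod_cast hk
  have hk0 : (0 : ℝ) < k := by linarith
  have hk1 : (0 : ℝ) < k - 1 := by linarith
  have hρ : 0 < ρ := hδ.trans_le hδρ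
  -- This gap, available only for ρ < 1/k, is the room for perturbing the columns other than z.
  have hρc : ρ < (1 - ρ) / (k - 1) := by
    rw [lt_div_iff₀ hk1]
    rw [lt_div_iff₀ hk0] at hρk
    linarith
  have hb : ∀ i, ρ ≤ pointedDist ρ z i := fun i => by
    unfold pointedDist
    split_ifs <;> linarith
  have hb1 := sum_pointedDist (ρ := ρ) hk z
  have hrow : ∀ (a : Fin k × Fin k) i, ∑ j, pointedDirection z a i j = 0 := fun a i => by
    by_cases h : i = a.1 ∧ a.2 ≠ z
    · simp only [pointedDirection, h.1, h.2, true_and, ne_eq, not_false_eq_true]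
      exact sum_ne_centeredUnit hk h.2
    · refine Finset.sum_eq_zero fun j _ => if_neg fun h' => h ⟨h'.1, h'.2.1⟩
  have hle : ∀ (a : Fin k × Fin k) i j, |pointedDirection z a i j| ≤ 1 := fun a i j => by
    unfold pointedDirection
    split_ifs
    · exact abs_centeredUnit_le (by linarith) _ _
    · simp
  have hc0 : 0 < (1 - ρ) / (k - 1) - ρ := by linarith
  refine ⟨⟨ρ, hρ, hb⟩, hb1, hrow, hle, fun a => ?_, ((1 - ρ) / (k - 1) - ρ) / (k * k + 1),
    by positivity, fun θ hθ => ?_⟩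
  · unfold pointedDirection
    split_ifs
    · have : 1 / ((k : ℝ) - 1) ≤ 1 := by rw [div_le_one hk1]; linarith
      simp only [centeredUnit, if_true]
      linarith
    · exact le_rfl
  have hclose := abs_perturbedKernel_sub_le (b := pointedDist ρ z) hle hc0.le hθ
  have hz : ∀ i, perturbedKernel (pointedDist ρ z) (pointedDirection z) θ i z = ρ := fun i => by
    simp [perturbedKernel, pointedDirection, pointedDist]
  have hρM : ∀ i j, ρ ≤ perturbedKernel (pointedDist ρ z) (pointedDirection z) θ i j := by
    intro i j
    rcases eq_or_ne j z with rfl | h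
    · rw [hz]
    · have := (abs_le.1 (hclose i j)).1
      rw [pointedDist, if_neg h] at this
      linarith
  have hM : Matrix.of (perturbedKernel (pointedDist ρ z) (pointedDirection z) θ) ∈
      Matrix.rowStochastic ℝ (Fin k) := Matrix.mem_rowStochastic_iff_sum.2
    ⟨fun i j => hρ.le.trans (hρM i j), sum_perturbedKernel hb1 hrow θ⟩
  obtain ⟨π, hπ, hπM⟩ := exists_stationary (by omega : 0 < k) hM
  have hπj : ∀ j, ∑ i, π i * perturbedKernel (pointedDist ρ z) (pointedDirection z) θ i j = π j :=
    fun j => congrFun hπM j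
  refine ⟨MarkovModel.ofProb _ π _ ⟨fun i => hρ.le.trans (hb i), hb1⟩ hM hπ hπM,
    ⟨fun i j => hδρ.trans (hρM i j), ⟨z, ?_⟩, ?_⟩, rfl, rfl⟩
  · change π z = ρ
    rw [← hπj z]
    simp only [hz, ← Finset.sum_mul, hπ.2, one_mul]
  · rintro _ ⟨j, rfl⟩
    change ρ ≤ π j
    rw [← hπj j]
    calc ρ = ∑ i, π i * ρ := by rw [← Finset.sum_mul, hπ.2, one_mul]
      _ ≤ _ := Finset.sum_le_sum fun i _ => mul_le_mul_of_nonneg_left (hρM i j) (hπ.1 i)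

/-- Row i is used with frequency b_i, so each of its k − 1 free entries contributes (1 − 1/(k −
1))/b_i, and column z contributes nothing. -/
theorem rowBound_pointed (hk : 3 ≤ k) (hρ : 0 < ρ) (hρ1 : ρ < 1) (z i : Fin k) :
    rowBound (pointedDist ρ z) (pointedDirection z) i = ((k : ℝ) - 2) / pointedDist ρ z i := by
  have hk3 : (3 : ℝ) ≤ k := by exact_mod_cast hk
  have hk1 : (0 : ℝ) < k - 1 := by linarith
  have hk2 : (0 : ℝ) < k - 2 := by linarith
  have hc : (0 : ℝ) < (1 - ρ) / (k - 1) := div_pos (by linarith) hk1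
  have hb : 0 < pointedDist ρ z i := by
    unfold pointedDist
    split_ifs <;> linarith
  set c := (1 - ρ) / ((k : ℝ) - 1) with hcdef
  have hI : ∀ j, j ≠ z → directionInfo (pointedDist ρ z) (pointedDirection z (i, j)) =
      pointedDist ρ z i / c * (1 - 1 / (k - 1)) := by
    intro j hj
    unfold directionInfo
    rw [Finset.sum_eq_single i]
    · have h1 : ∀ l, pointedDirection z (i, j) i l ^ 2 / pointedDist ρ z l =
          c⁻¹ * (centeredUnit ((k : ℝ) - 1) j l ^ 2 -
            if l = z then (1 / ((k : ℝ) - 1)) ^ 2 else 0) := by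
        intro l
        rcases eq_or_ne l z with rfl | hl
        · simp [pointedDirection, centeredUnit, hj.symm]
        · have h2 : pointedDirection z (i, j) i l = centeredUnit ((k : ℝ) - 1) j l :=
            if_pos ⟨rfl, hj, hl⟩
          rw [h2, pointedDist, if_neg hl, if_neg hl, sub_zero, ← hcdef]
          ring
      simp only [h1]
      rw [← Finset.mul_sum, Finset.sum_sub_distrib, sum_centeredUnit_sq]
      simp only [Finset.sum_ite_eq', Finset.mem_univ, if_true]
      field_simp
      ring
    · intro l _ hl
      simp [pointedDirection, hl]
    · simp
  have hterm : ∀ j, pointedDirection z (i, j) i j ^ 2 / (pointedDist ρ z j *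
      directionInfo (pointedDist ρ z) (pointedDirection z (i, j))) =
      (1 - 1 / ((k : ℝ) - 1)) / pointedDist ρ z i * (1 - if j = z then 1 else 0) := by
    intro j
    rcases eq_or_ne j z with rfl | hj
    · simp [pointedDirection]
    · rw [hI j hj]
      have h2 : 1 - 1 / ((k : ℝ) - 1) = (k - 2) / (k - 1) := by field_simp; ring
      have h3 : pointedDist ρ z j = c := by rw [pointedDist, if_neg hj]
      have h4 : pointedDirection z (i, j) i j = (k - 2) / (k - 1) := by
        simp only [pointedDirection, centeredUnit, hj, ne_eq, not_false_eq_true, and_self, if_true,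
          h2]
      rw [h3, h4, h2, if_neg hj]
      field_simp
      ring
  unfold rowBound
  simp only [hterm]
  rw [← Finset.mul_sum, Finset.sum_sub_distrib]
  simp only [Finset.sum_ite_eq', Finset.mem_univ, if_true, Finset.sum_const, Finset.card_univ,
    Fintype.card_fin, nsmul_eq_mul, mul_one]
  field_simp
  ring

/-- Needed for the pointed family, whose column z has the entries ρ, to meet the constraint that
entries be at least δ. -/
theorem le_of_chainClass_nonempty (hne : (chainClass k δ ρ).Nonempty) : δ ≤ ρ := by
  obtain ⟨P, hP, ⟨i, hi⟩, -⟩ := hne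
  rw [← hi, ← P.sum_stat_mul_prob i]
  calc δ = ∑ j, P.stat j * δ := by rw [← Finset.sum_mul, P.stat_mem.2, one_mul]
    _ ≤ _ := Finset.sum_le_sum fun j _ => mul_le_mul_of_nonneg_left (hP j i) (P.stat_mem.1 j)

end Families

/-! ### Assembly of the lower bounds and the one-state case -/

section Minimax

variable {k : ℕ} {δ ρ : ℝ} {f : ℝ → ℝ}

theorem AsympLE.of_eventually_le {a b : ℕ → EReal} (h : ∀ᶠ n in atTop, a n ≤ b n) :
    AsympLE a b :=
  ⟨fun _ => 0, tendsto_const_nhds, by simpa using h⟩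

theorem IsOrdinary.asympLE_minimax_of_three_le (hf : IsOrdinary f) (hk : 3 ≤ k) (hδ : 0 < δ)
    (hδk : δ < 1 / (k : ℝ)) (hρ : 0 < ρ) (hρk : ρ ≤ 1 / (k : ℝ))
    (hne : (chainClass k δ ρ).Nonempty) :
    (∀ᶠ n : ℕ in atTop,
      (((1 - ρ) * (((k : ℝ) - 2) * k * iteratedDeriv 2 f 1 / (2 * n)) : ℝ) : EReal) ≤
        minimaxWeighted (fDiv f) (chainClass k δ ρ) n) ∧
    ∀ᶠ n : ℕ in atTop,
      (((1 - ρ) * (((k : ℝ) - 2) * iteratedDeriv 2 f 1 / (2 * n * ρ)) : ℝ) : EReal) ≤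
        minimaxWorst (fDiv f) (chainClass k δ ρ) n := by
  have hA := hf.deriv_two_pos
  set A := iteratedDeriv 2 f 1
  have hk3 : (3 : ℝ) ≤ k := by exact_mod_cast hk
  have hk0 : (0 : ℝ) < k := by linarith
  have hk2 : (0 : ℝ) < k - 2 := by linarith
  have hρ1 : ρ < 1 := hρk.trans_lt (by rw [div_lt_one hk0]; linarith)
  have hη0 : 0 < ρ / 2 := by linarith
  have hη1 : ρ / 2 < 1 := by linarith
  -- With η = ρ/2 the factor 1 − ρ absorbs all losses, so the lower bounds hold eventually without
  -- any error term.
  have hη : 1 - ρ ≤ (1 - ρ / 2) ^ 2 := by nlinarith [sq_nonneg ρ]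
  let z : Fin k := ⟨0, by omega⟩
  rcases hρk.lt_or_eq with hlt | heq
  · have hS := isPerturbationFamily_pointed (by omega : 2 ≤ k) hδ (le_of_chainClass_nonempty hne)
      hlt z
    have hrow := rowBound_pointed hk hρ hρ1 z
    constructor
    · filter_upwards [hf.eventually_le_minimaxWeighted hδ hne hS hη0 hη1, eventually_gt_atTop 0]
        with n hn hn0
      refine le_trans ?_ hn
      have hn0' : (0 : ℝ) < n := by exact_mod_cast hn0
      rw [EReal.coe_le_coe_iff]
      have hsum : ∑ i, pointedDist ρ z i * rowBound (pointedDist ρ z) (pointedDirection z) i =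
          k * (k - 2) := by
        have : ∀ i, pointedDist ρ z i * rowBound (pointedDist ρ z) (pointedDirection z) i =
            k - 2 := fun i => by
          obtain ⟨β, hβ, hb⟩ := hS.pos
          have := (hβ.trans_le (hb i)).ne'
          rw [hrow]
          field_simp
        simp only [this, Finset.sum_const, Finset.card_univ, Fintype.card_fin, nsmul_eq_mul]
      rw [hsum]
      calc _ = (1 - ρ) * ((A / 2) / n * (k * (k - 2))) := by field_simp
        _ ≤ (1 - ρ / 2) ^ 2 * ((A / 2) / n * (k * (k - 2))) := by gcongr
        _ = _ := by ring
    · filter_upwards [hf.eventually_le_minimaxWorst hδ hne hS hη0 hη1 z, eventually_gt_atTop 0]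
        with n hn hn0
      refine le_trans ?_ hn
      have hn0' : (0 : ℝ) < n := by exact_mod_cast hn0
      rw [EReal.coe_le_coe_iff, hrow z, pointedDist, if_pos rfl]
      calc _ = (1 - ρ) * ((A / 2) / n * ((k - 2) / ρ)) := by field_simp
        _ ≤ (1 - ρ / 2) * ((A / 2) / n * ((k - 2) / ρ)) := by gcongr; linarith
        _ = _ := by ring
  · subst heq
    have hS := isPerturbationFamily_uniform (by omega : 0 < k) hδ hδk
    have hrow := rowBound_uniform (by omega : 2 ≤ k)
    -- The doubly stochastic family has (k − 1)² parameters, one more than the k (k − 2) required by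
    -- the claim.
    have hkk : ((k : ℝ) - 2) * k ≤ (k - 1) ^ 2 := by nlinarith
    have h1k : 0 < 1 - 1 / (k : ℝ) := by linarith
    constructor
    · filter_upwards [hf.eventually_le_minimaxWeighted hδ hne hS hη0 hη1, eventually_gt_atTop 0]
        with n hn hn0
      refine le_trans ?_ hn
      have hn0' : (0 : ℝ) < n := by exact_mod_cast hn0
      rw [EReal.coe_le_coe_iff]
      have hsum : ∑ i : Fin k, (1 / (k : ℝ)) * rowBound (fun _ => 1 / (k : ℝ)) uniformDirection i =
          (k - 1) ^ 2 := by
        simp only [hrow]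
        simp [hk0.ne']
      rw [hsum]
      calc _ = (1 - 1 / (k : ℝ)) * ((A / 2) / n * ((k - 2) * k)) := by field_simp
        _ ≤ (1 - 1 / (k : ℝ) / 2) ^ 2 * ((A / 2) / n * (k - 1) ^ 2) := by gcongr
        _ = _ := by ring
    · filter_upwards [hf.eventually_le_minimaxWorst hδ hne hS hη0 hη1 z, eventually_gt_atTop 0]
        with n hn hn0
      refine le_trans ?_ hn
      have hn0' : (0 : ℝ) < n := by exact_mod_cast hn0
      rw [EReal.coe_le_coe_iff, hrow z]
      calc _ = (1 - 1 / (k : ℝ)) * ((A / 2) / n * ((k - 2) * k)) := by field_simp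
        _ ≤ (1 - 1 / (k : ℝ) / 2) * ((A / 2) / n * (k - 1) ^ 2) := by
            have : 1 - 1 / (k : ℝ) ≤ 1 - 1 / (k : ℝ) / 2 := by linarith
            gcongr
        _ = _ := by ring

theorem IsOrdinary.stateRisk_eq_zero (hf : IsOrdinary f) {n : ℕ} (P : MarkovModel 1)
    (E : Estimator n 1) (i : Fin 1) : stateRisk (fDiv f) P E i = 0 := by
  refine Finset.sum_eq_zero fun x _ => ?_
  have h1 : ∀ j, P.trans i j = 1 := fun j => by
    have := P.sum_prob i
    rw [Fin.sum_univ_one] at this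
    rwa [Subsingleton.elim j 0]
  have h2 : ∀ j, (E x).1 i j = 1 := fun j => by
    have := (Matrix.mem_rowStochastic_iff_sum.1 (E x).2).2 i
    rw [Fin.sum_univ_one] at this
    rwa [Subsingleton.elim j 0]
  have h3 : fDiv f (P.trans i) ((E x).1 i) = 0 := by
    rw [fDiv, Fin.sum_univ_one, h1, h2, fDivTerm]
    simp [hf.map_one]
  rw [h3, mul_zero]

end Minimax

end

theorem theorem3 (k : ℕ) (δ ρ : ℝ) (hδ : 0 < δ) (hδk : δ < 1 / (k : ℝ))
    (hρ : 0 < ρ) (hρk : ρ ≤ 1 / (k : ℝ)) (hne : (chainClass k δ ρ).Nonempty)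
    (f : ℝ → ℝ) (hf : IsOrdinary f) :
    (AsympLE
        (fun n => (((1 - ρ) * (((k : ℝ) - 2) * k * iteratedDeriv 2 f 1 / (2 * n)) : ℝ) : EReal))
        (minimaxWeighted (fDiv f) (chainClass k δ ρ)) ∧
      AsympLE (minimaxWeighted (fDiv f) (chainClass k δ ρ))
        (fun n => ((((k : ℝ) - 1) * k * iteratedDeriv 2 f 1 / (2 * n) : ℝ) : EReal))) ∧
    (AsympLE
        (fun n => (((1 - ρ) * (((k : ℝ) - 2) * iteratedDeriv 2 f 1 / (2 * n * ρ)) : ℝ) : EReal))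
        (minimaxWorst (fDiv f) (chainClass k δ ρ)) ∧
      AsympLE (minimaxWorst (fDiv f) (chainClass k δ ρ))
        (fun n => ((((k : ℝ) - 1) * iteratedDeriv 2 f 1 / (2 * n * ρ) : ℝ) : EReal))) := by
  have hA := hf.deriv_two_pos
  have hk : 0 < k := by
    rcases Nat.eq_zero_or_pos k with rfl | h
    · norm_num at hδk
      linarith
    · exact h
  have hlow : AsympLE
        (fun n => (((1 - ρ) * (((k : ℝ) - 2) * k * iteratedDeriv 2 f 1 / (2 * n)) : ℝ) : EReal))
        (minimaxWeighted (fDiv f) (chainClass k δ ρ)) ∧ AsympLE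
        (fun n => (((1 - ρ) * (((k : ℝ) - 2) * iteratedDeriv 2 f 1 / (2 * n * ρ)) : ℝ) : EReal))
        (minimaxWorst (fDiv f) (chainClass k δ ρ)) := by
    rcases Nat.lt_or_ge k 3 with h | h
    · have hk2 : (k : ℝ) - 2 ≤ 0 := by
        have : (k : ℝ) ≤ 2 := by exact_mod_cast Nat.lt_succ_iff.1 h
        linarith
      have hk1 : (1 : ℝ) ≤ k := by exact_mod_cast hk
      have hρ1 : 0 ≤ 1 - ρ := by
        have : 1 / (k : ℝ) ≤ 1 := by rw [div_le_one (by linarith)]; exact hk1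
        linarith
      refine ⟨AsympLE.of_eventually_le (Eventually.of_forall fun n =>
        le_trans ?_ (hf.minimaxWeighted_nonneg hδ hne)),
        AsympLE.of_eventually_le (Eventually.of_forall fun n =>
        le_trans ?_ (hf.minimaxWorst_nonneg hk hδ hne))⟩
      · rw [← EReal.coe_zero, EReal.coe_le_coe_iff]
        refine mul_nonpos_of_nonneg_of_nonpos hρ1 (div_nonpos_of_nonpos_of_nonneg ?_ (by positivity))
        exact mul_nonpos_of_nonpos_of_nonneg
          (mul_nonpos_of_nonpos_of_nonneg hk2 (by positivity)) hA.le
      · rw [← EReal.coe_zero, EReal.coe_le_coe_iff]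
        refine mul_nonpos_of_nonneg_of_nonpos hρ1 (div_nonpos_of_nonpos_of_nonneg ?_ (by positivity))
        exact mul_nonpos_of_nonpos_of_nonneg hk2 hA.le
    · have := hf.asympLE_minimax_of_three_le h hδ hδk hρ hρk hne
      exact ⟨AsympLE.of_eventually_le this.1, AsympLE.of_eventually_le this.2⟩
  refine ⟨⟨hlow.1, ?_⟩, hlow.2, ?_⟩
  · rcases (show 1 ≤ k from hk).eq_or_lt with rfl | h
    · refine AsympLE.of_eventually_le (Eventually.of_forall fun n => ?_)
      let E : Estimator n 1 := fun _ => 1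
      refine (iInf_le _ E).trans (iSup₂_le fun P _ => ?_)
      simp [weightedRisk, hf.stateRisk_eq_zero]
    · exact hf.minimaxWeighted_asympLE h hδ hδk hρ
  · rcases (show 1 ≤ k from hk).eq_or_lt with rfl | h
    · refine AsympLE.of_eventually_le (Eventually.of_forall fun n => ?_)
      let E : Estimator n 1 := fun _ => 1
      refine (iInf_le _ E).trans (iSup₂_le fun P _ => ?_)
      simp [worstRisk, hf.stateRisk_eq_zero]
    · exact hf.minimaxWorst_asympLE h hδ hδk hρ
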